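/- Let $\mathcal H$ be a complex Hilbert space of finite dimension $d\ge 1$. A state is a positive semidefinite operator on $\mathcal H$ of trace $1$; it is pure if it is a rank-one projection; $\tau=\mathbb 1/d$. Write $\|A\|_1=\operatorname{tr}|A|$, let $S(\rho)=-\operatorname{tr}(\rho\log\rho)$ be the von Neumann entropy, let $h(\varepsilon)=-\varepsilon\log\varepsilon-(1-\varepsilon)\log(1-\varepsilon)$ (logarithms to base $2$, $0\log 0=0$), and let $B_\varepsilon(\sigma)$ be the set of states $\omega$ with $\tfrac12\|\omega-\sigma\|_1\le\varepsilon$. Let $\sigma$ be a state, $\varepsilon\in(0,1]$, and let $\sigma=\sum_{i=1}^d\mu_i|i\rangle\langle i|$ be any eigen-decomposition of $\sigma$ in an orthonormal basis with $\mu_1\ge\dots\ge\mu_d$. Define two states as follows. * If $\tfrac12\|\sigma-\tau\|_1\le\varepsilon$, put $\rho^*_\varepsilon(\sigma)=\tau$. Otherwise let $(\alpha_1,n)$ and $(\alpha_2,m)$ be the unique pairs in $[0,1]\times\{1,\dots,d-1\}$ with $\sum_{i=d-n+1}^d|\alpha_1-\mu_i|=\varepsilon$, $\mu_{d-n+1}<\alpha_1\le\mu_{d-n}$,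 and $\sum_{i=1}^m|\alpha_2-\mu_i|=\varepsilon$, $\mu_{m+1}\le\alpha_2<\mu_m$, and put $$\rho^*_\varepsilon(\sigma)=\sum_{i\le m}\alpha_2|i\rangle\langle i|+\sum_{m<i\le d-n}\mu_i|i\rangle\langle i|+\sum_{i>d-n}\alpha_1|i\rangle\langle i|.$$ * Let $Q_\ell=\sum_{j=d-\ell+1}^d\mu_j$ and let $\ell\in\{0,\dots,d-1\}$ be the largest index with $Q_\ell\le\varepsilon$. Put $\rho_{*,\varepsilon}(\sigma)=\sum_{i}p_i|i\rangle\langle i|$, where $p=(1,0,\dots,0)$ if $\ell=d-1$, and otherwise $p_1=\mu_1+\varepsilon$, $p_j=\mu_j$ for $2\le j\le d-\ell-1$, $p_{d-\ell}=\mu_{d-\ell}-(\varepsilon-Q_\ell)$, and $p_j=0$ for $j\ge d-\ell+1$. Then for every $\omega\in B_\varepsilon(\sigma)$, $$|S(\omega)-S(\sigma)|\le\max\{S(\rho^*_\varepsilon(\sigma))-S(\sigma),\;S(\sigma)-S(\rho_{*,\varepsilon}(\sigma))\},$$ and $$\max\{S(\rho^*_\varepsilon(\sigma))-S(\sigma),\;S(\sigma)-S(\rho_{*,\varepsilon}(\sigma))\}\le\begin{cases}\varepsilon\log(d-1)+h(\varepsilon)&\text{if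 }\varepsilon<1-\frac1d,\\ \log d&\text{if }\varepsilon\ge1-\frac1d.\end{cases}$$ Moreover, equality holds in the second inequality if and only if one of the following holds: 1. $\sigma$ is a pure state; in this case $\rho^*_\varepsilon(\sigma)=\operatorname{diag}(1-\varepsilon,\frac{\varepsilon}{d-1},\dots,\frac{\varepsilon}{d-1})$ in the basis $(|i\rangle)_i$ if $\varepsilon<1-\frac1d$, and $\rho^*_\varepsilon(\sigma)=\tau$ if $\varepsilon\ge1-\frac1d$; 2. $\varepsilon<1-\frac1d$ and $\sigma=\operatorname{diag}(1-\varepsilon,\frac{\varepsilon}{d-1},\dots,\frac{\varepsilon}{d-1})$ in some orthonormal basis; in this case $\rho_{*,\varepsilon}(\sigma)$ is a pure state; 3. $\varepsilon\ge1-\frac1d$ and $\sigma=\tau$; in this case $\rho_{*,\varepsilon}(\sigma)$ is a pure state. -/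

import Mathlib

namespace LocalEntropyBound

noncomputable section

variable {H : Type*} [NormedAddCommGroup H] [InnerProductSpace ℂ H]

/-- The real part of the trace of an operator on a finite-dimensional Hilbert space (the trace of
a self-adjoint operator is real). -/
def reTrace (A : H →L[ℂ] H) : ℝ := (LinearMap.trace ℂ H (A : H →ₗ[ℂ] H)).re

/-- A quantum state (density operator): a positive semidefinite operator of trace one. -/
def IsState (ρ : H →L[ℂ] H) : Prop :=
  ρ.IsPositive ∧ LinearMap.trace ℂ H (ρ : H →ₗ[ℂ] H) = 1

/-- A pure state: the rank-one projection `|ψ⟩⟨ψ|` onto a unit vector. -/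
def IsPure (ρ : H →L[ℂ] H) : Prop :=
  ∃ ψ : H, ‖ψ‖ = 1 ∧ ρ = InnerProductSpace.rankOne ℂ ψ ψ

/-- The trace norm `‖A‖₁ = tr |A|`. -/
def traceNorm [CompleteSpace H] (A : H →L[ℂ] H) : ℝ := reTrace (CFC.abs A)

/-- The `ε`-ball of states around `σ` in trace distance. -/
def ball [CompleteSpace H] (ε : ℝ) (σ : H →L[ℂ] H) : Set (H →L[ℂ] H) :=
  {ω | IsState ω ∧ traceNorm (ω - σ) / 2 ≤ ε}

/-- The von Neumann entropy `S(ρ) = - tr (ρ log ρ)` with logarithm to base 2, the logarithm being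
taken by functional calculus (on the kernel of `ρ` the convention is `0 log 0 = 0`). -/
def vonNeumannEntropy [CompleteSpace H] (ρ : H →L[ℂ] H) : ℝ :=
  - reTrace (ρ * cfc (Real.logb 2) ρ)

/-- The completely mixed state `τ = 𝟙 / d`. -/
def mixedState (H : Type*) [NormedAddCommGroup H] [InnerProductSpace ℂ H] : H →L[ℂ] H :=
  ((Module.finrank ℂ H : ℂ)⁻¹) • (1 : H →L[ℂ] H)

/-- The operator `∑ i, v i |b i⟩⟨b i|`, i.e. `diag(v)` in the orthonormal basis `b`. -/
def diagOp {d : ℕ} (b : OrthonormalBasis (Fin d) ℂ H) (v : Fin d → ℝ) : H →L[ℂ] H :=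
  ∑ i, ((v i : ℝ) : ℂ) • InnerProductSpace.rankOne ℂ (b i) (b i)

/-- `σ = ∑ i, μ i |b i⟩⟨b i|` with `μ` non-increasing: a sorted eigen-decomposition of `σ`. -/
def IsSortedEigenDecomposition {d : ℕ} (σ : H →L[ℂ] H) (b : OrthonormalBasis (Fin d) ℂ H)
    (μ : Fin d → ℝ) : Prop :=
  Antitone μ ∧ σ = diagOp b μ

/-- Every state has a sorted eigen-decomposition. -/
theorem exists_isSortedEigenDecomposition [FiniteDimensional ℂ H] {d : ℕ}
    (hd : Module.finrank ℂ H = d) (σ : H →L[ℂ] H) (hσ : IsState σ) :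
    ∃ (b : OrthonormalBasis (Fin d) ℂ H) (μ : Fin d → ℝ), IsSortedEigenDecomposition σ b μ := by
  have hs : (σ : H →ₗ[ℂ] H).IsSymmetric := hσ.1.isSymmetric
  refine ⟨hs.eigenvectorBasis hd, hs.eigenvalues hd, hs.eigenvalues_antitone hd, ?_⟩
  have key : (σ : H →ₗ[ℂ] H) =
      ((diagOp (hs.eigenvectorBasis hd) (hs.eigenvalues hd) : H →L[ℂ] H) : H →ₗ[ℂ] H) := by
    refine (hs.eigenvectorBasis hd).toBasis.ext fun i => ?_
    have h := hs.apply_eigenvectorBasis hd i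
    simp only [OrthonormalBasis.coe_toBasis]
    rw [h]
    simp [diagOp, InnerProductSpace.rankOne_apply, OrthonormalBasis.inner_eq_ite]
  exact ContinuousLinearMap.coe_injective key

/-! In the following, the entry with index `i : Fin d` is entry number `j = i + 1` in the usual
numbering `1, …, d`. -/

/-- The pair `p = (α₁, n) ∈ [0,1] × {1, …, d-1}` satisfies
`∑_{j = d-n+1}^d |α₁ - μ_j| = ε` and `μ_{d-n+1} < α₁ ≤ μ_{d-n}`. -/
def IsLowLevel {d : ℕ} (μ : Fin d → ℝ) (ε : ℝ) (p : ℝ × ℕ) : Prop :=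
  p.1 ∈ Set.Icc (0 : ℝ) 1 ∧ 1 ≤ p.2 ∧ p.2 + 1 ≤ d ∧
  (∑ i with d ≤ (i : Fin d).val + p.2, |p.1 - μ i|) = ε ∧
  (∀ i : Fin d, i.val + p.2 = d → μ i < p.1) ∧
  (∀ i : Fin d, i.val + 1 + p.2 = d → p.1 ≤ μ i)

/-- The pair `p = (α₂, m) ∈ [0,1] × {1, …, d-1}` satisfies
`∑_{j = 1}^m |α₂ - μ_j| = ε` and `μ_{m+1} ≤ α₂ < μ_m`. -/
def IsHighLevel {d : ℕ} (μ : Fin d → ℝ) (ε : ℝ) (p : ℝ × ℕ) : Prop :=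
  p.1 ∈ Set.Icc (0 : ℝ) 1 ∧ 1 ≤ p.2 ∧ p.2 + 1 ≤ d ∧
  (∑ i with (i : Fin d).val < p.2, |p.1 - μ i|) = ε ∧
  (∀ i : Fin d, i.val = p.2 → μ i ≤ p.1) ∧
  (∀ i : Fin d, i.val + 1 = p.2 → p.1 < μ i)

/-- The pair `(α₁, n)` characterized by `IsLowLevel`. -/
def lowLevel {d : ℕ} (μ : Fin d → ℝ) (ε : ℝ) : ℝ × ℕ := Classical.epsilon (IsLowLevel μ ε)

/-- The pair `(α₂, m)` characterized by `IsHighLevel`. -/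
def highLevel {d : ℕ} (μ : Fin d → ℝ) (ε : ℝ) : ℝ × ℕ := Classical.epsilon (IsHighLevel μ ε)

/-- The `n` lowest entries of `μ` are raised to `α₁`, the `m` highest are lowered to `α₂`, and the
others are kept. -/
def flattened {d : ℕ} (μ : Fin d → ℝ) (ε : ℝ) : Fin d → ℝ := fun i =>
  if d ≤ i.val + (lowLevel μ ε).2 then (lowLevel μ ε).1
  else if i.val < (highLevel μ ε).2 then (highLevel μ ε).1
  else μ i

open Classical in
/-- The state `ρ^*_ε(σ)` built from a sorted eigen-decomposition `σ = ∑ i, μ i |b i⟩⟨b i|`; it is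
`τ` when `τ` lies in the `ε`-ball around `σ`. -/
def rhoUpper [CompleteSpace H] {d : ℕ} (ε : ℝ) (σ : H →L[ℂ] H)
    (b : OrthonormalBasis (Fin d) ℂ H) (μ : Fin d → ℝ) : H →L[ℂ] H :=
  if traceNorm (σ - mixedState H) / 2 ≤ ε then mixedState H
  else diagOp b (flattened μ ε)

/-- The sum `Q_ℓ` of the last `ℓ` (for sorted `q`: the `ℓ` smallest) entries of `q`. -/
def tailSum {d : ℕ} (q : Fin d → ℝ) (l : ℕ) : ℝ := ∑ i with d ≤ (i : Fin d).val + l, q i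

open Classical in
/-- The largest `ℓ ∈ {0, …, d-1}` with `Q_ℓ ≤ ε`; for a probability vector and `ε > 0`, `d ≥ 2` it
is `0` exactly when `q_d > ε`. -/
def tailIndex {d : ℕ} (q : Fin d → ℝ) (ε : ℝ) : ℕ :=
  Nat.findGreatest (fun l => tailSum q l ≤ ε) (d - 1)

/-- The probability vector `p_{*,ε}(q)`. With `ℓ = tailIndex q ε`, it is `(1, 0, …, 0)` if
`ℓ = d - 1`, and otherwise it has the entries `q_1 + ε` at `j = 1`, `q_j` for `2 ≤ j ≤ d - ℓ - 1`,
`q_{d-ℓ} - (ε - Q_ℓ)` at `j = d - ℓ`, and `0` for `j ≥ d - ℓ + 1`. In particular, if `q_d > ε` and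
`d ≥ 2` it is `(q_1 + ε, q_2, …, q_{d-1}, q_d - ε)`. -/
def steepened {d : ℕ} (q : Fin d → ℝ) (ε : ℝ) : Fin d → ℝ := fun i =>
  if tailIndex q ε + 1 = d then (if i.val = 0 then 1 else 0)
  else if i.val = 0 then q i + ε
  else if i.val + 1 + tailIndex q ε < d then q i
  else if i.val + 1 + tailIndex q ε = d then q i - (ε - tailSum q (tailIndex q ε))
  else 0

/-- The state `ρ_{*,ε}(σ)` built from a sorted eigen-decomposition `σ = ∑ i, q i |b i⟩⟨b i|`. -/
def rhoLower {d : ℕ} (ε : ℝ) (b : OrthonormalBasis (Fin d) ℂ H) (q : Fin d → ℝ) : H →L[ℂ] H :=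
  diagOp b (steepened q ε)

/-- The binary entropy, to base 2. -/
def binaryEntropy (ε : ℝ) : ℝ := -ε * Real.logb 2 ε - (1 - ε) * Real.logb 2 (1 - ε)

open Classical in
/-- The right-hand side of the Audenaert–Fannes bound in dimension `d`. -/
def audenaertFannes (d : ℕ) (ε : ℝ) : ℝ :=
  if ε < 1 - 1 / (d : ℝ) then ε * Real.logb 2 ((d : ℝ) - 1) + binaryEntropy ε
  else Real.logb 2 (d : ℝ)

/-- The probability vector `(1 - ε, ε/(d-1), …, ε/(d-1))`. -/
def spikeVector (d : ℕ) (ε : ℝ) : Fin d → ℝ := fun i =>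
  if i.val = 0 then 1 - ε else ε / ((d : ℝ) - 1)

end

end LocalEntropyBound

/-! Everything reduces to probability vectors. For operators diagonal in an orthonormal basis,
entropy and trace norm depend only on the diagonal, and pinching onto the eigenbasis of `σ` neither
increases the trace distance to `σ` nor decreases the entropy.

Upper side: the pinched `ω` is a probability vector `w` within `ε` of `μ`. If `τ` is out of reach,
let `r` be the truncation of `μ` to an interval `[a, c]` around `1/d`. By Gibbs' inequality the
entropy of `w` is at most `∑ w (-log r)`. This linear functional is largest when mass `ε` is moved
from where `-log r` is smallest, namely `-log c`, to where it is largest, namely `-log a`; that is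
what `r` does (`sum_negMulLog_le_flattened`).

Lower side: by Ky Fan (`prefix_eigenvalue_le`) the partial sums of the sorted spectrum of `ω` exceed
those of `μ` by at most `ε`. The steepened vector attains this bound, capped at `1`, so it majorizes
the spectrum of `ω`, and Schur concavity applies.

The dimension bound for `ε < 1 - 1/d` is a Fano argument (`audenaertFannes_classical`). Couple `p`
and `q` with off-diagonal mass at most `ε`; the entropy difference is at most the conditional
entropy of the coupling, which Gibbs' inequality compares with the kernel that stays with
probability `1 - ε` and otherwise moves uniformly. Equality forces `q` to be a point mass and `p`
its spike. Applied to the pairs (flattened, `μ`) and (`μ`, steepened), this gives the pure and the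
spike case. For `ε ≥ 1 - 1/d` it is enough that entropies lie between `0` and `log d`. -/

namespace LocalEntropyBound

/-! ### Operators diagonal in an orthonormal basis, and pinching. -/

section Operators

variable {H : Type*} [NormedAddCommGroup H] [InnerProductSpace ℂ H] {d : ℕ}

theorem diagOp_apply_self (b : OrthonormalBasis (Fin d) ℂ H) (v : Fin d → ℝ) (j : Fin d) :
    diagOp b v (b j) = ((v j : ℝ) : ℂ) • b j := by
  simp [diagOp, InnerProductSpace.rankOne_apply, OrthonormalBasis.inner_eq_ite]

theorem ext_orthonormalBasis (b : OrthonormalBasis (Fin d) ℂ H) {A B : H →L[ℂ] H}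
    (h : ∀ j, A (b j) = B (b j)) : A = B := by
  apply ContinuousLinearMap.coe_injective
  refine b.toBasis.ext fun i => ?_
  simpa using h i

theorem diagOp_mul (b : OrthonormalBasis (Fin d) ℂ H) (v w : Fin d → ℝ) :
    diagOp b v * diagOp b w = diagOp b (fun i => v i * w i) := by
  refine ext_orthonormalBasis b fun j => ?_
  change diagOp b v (diagOp b w (b j)) = _
  simp only [diagOp_apply_self, map_smul, smul_smul, Complex.ofReal_mul, mul_comm]

theorem diagOp_add (b : OrthonormalBasis (Fin d) ℂ H) (v w : Fin d → ℝ) :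
    diagOp b v + diagOp b w = diagOp b (fun i => v i + w i) := by
  refine ext_orthonormalBasis b fun j => ?_
  simp [diagOp_apply_self, add_smul]

theorem diagOp_sub (b : OrthonormalBasis (Fin d) ℂ H) (v w : Fin d → ℝ) :
    diagOp b v - diagOp b w = diagOp b (fun i => v i - w i) := by
  refine ext_orthonormalBasis b fun j => ?_
  simp [diagOp_apply_self, sub_smul]

theorem diagOp_const (b : OrthonormalBasis (Fin d) ℂ H) (r : ℝ) :
    diagOp b (fun _ => r) = algebraMap ℝ (H →L[ℂ] H) r := by
  refine ext_orthonormalBasis b fun j => ?_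
  rw [diagOp_apply_self, Algebra.algebraMap_eq_smul_one]
  simp

theorem mixedState_eq_diagOp (hd : Module.finrank ℂ H = d)
    (b : OrthonormalBasis (Fin d) ℂ H) :
    mixedState H = diagOp b (fun _ => 1 / (d : ℝ)) := by
  refine ext_orthonormalBasis b fun j => ?_
  rw [diagOp_apply_self]
  simp [mixedState, hd]

theorem diagOp_single (b : OrthonormalBasis (Fin d) ℂ H) (j : Fin d) :
    diagOp b (fun i => if i = j then 1 else 0) = InnerProductSpace.rankOne ℂ (b j) (b j) := by
  simp [diagOp, apply_ite]

theorem diagOp_reindex (b : OrthonormalBasis (Fin d) ℂ H) (v : Fin d → ℝ)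
    (e : Equiv.Perm (Fin d)) :
    diagOp (b.reindex e) v = diagOp b (fun i => v (e i)) := by
  refine ext_orthonormalBasis b fun j => ?_
  rw [diagOp_apply_self]
  have := diagOp_apply_self (b.reindex e) v (e j)
  simpa using this

theorem diagOp_isSelfAdjoint [CompleteSpace H] (b : OrthonormalBasis (Fin d) ℂ H)
    (v : Fin d → ℝ) : IsSelfAdjoint (diagOp b v) := by
  unfold diagOp
  refine isSelfAdjoint_sum _ fun i _ => ?_
  refine IsSelfAdjoint.smul ?_ ?_
  · simp [IsSelfAdjoint]
  · exact (InnerProductSpace.isPositive_rankOne_self (𝕜 := ℂ) (b i)).isSelfAdjoint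

theorem exists_eq_diagOp [CompleteSpace H] [FiniteDimensional ℂ H]
    (hd : Module.finrank ℂ H = d) {A : H →L[ℂ] H} (hA : IsSelfAdjoint A) :
    ∃ (b : OrthonormalBasis (Fin d) ℂ H) (v : Fin d → ℝ), A = diagOp b v := by
  have hs : (A : H →ₗ[ℂ] H).IsSymmetric := hA.isSymmetric
  refine ⟨hs.eigenvectorBasis hd, hs.eigenvalues hd, ?_⟩
  refine ext_orthonormalBasis (hs.eigenvectorBasis hd) fun j => ?_
  rw [diagOp_apply_self]
  exact hs.apply_eigenvectorBasis hd j

/-- The diagonal entry `⟨e i|A|e i⟩` (its real part). -/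
noncomputable def diagEntry (e : OrthonormalBasis (Fin d) ℂ H) (A : H →L[ℂ] H) (i : Fin d) : ℝ :=
  (inner ℂ (e i) (A (e i))).re

theorem diagEntry_sub (e : OrthonormalBasis (Fin d) ℂ H) (A B : H →L[ℂ] H) (i : Fin d) :
    diagEntry e (A - B) i = diagEntry e A i - diagEntry e B i := by
  simp [diagEntry]

theorem reTrace_eq_sum_diagEntry (e : OrthonormalBasis (Fin d) ℂ H) (A : H →L[ℂ] H) :
    reTrace A = ∑ i, diagEntry e A i := by
  simp [reTrace, diagEntry, LinearMap.trace_eq_sum_inner _ e]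

theorem diagEntry_diagOp_self (e : OrthonormalBasis (Fin d) ℂ H) (v : Fin d → ℝ) (i : Fin d) :
    diagEntry e (diagOp e v) i = v i := by
  simp [diagEntry, diagOp_apply_self]

theorem reTrace_diagOp (e : OrthonormalBasis (Fin d) ℂ H) (v : Fin d → ℝ) :
    reTrace (diagOp e v) = ∑ i, v i := by
  simp [reTrace_eq_sum_diagEntry e, diagEntry_diagOp_self]

/-- The transition probabilities between two orthonormal bases. -/
noncomputable def overlap (e b : OrthonormalBasis (Fin d) ℂ H) (i j : Fin d) : ℝ :=
  ‖inner ℂ (e i) (b j)‖ ^ 2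

theorem overlap_nonneg (e b : OrthonormalBasis (Fin d) ℂ H) (i j : Fin d) :
    0 ≤ overlap e b i j := by unfold overlap; positivity

theorem sum_overlap_left (e b : OrthonormalBasis (Fin d) ℂ H) (j : Fin d) :
    ∑ i, overlap e b i j = 1 := by
  simp [overlap, e.sum_sq_norm_inner_right]

theorem sum_overlap_right (e b : OrthonormalBasis (Fin d) ℂ H) (i : Fin d) :
    ∑ j, overlap e b i j = 1 := by
  simp [overlap, b.sum_sq_norm_inner_left]

/-- The weights are doubly stochastic, so diagonal entries are averages of eigenvalues; pinching and
Ky Fan's bound both rest on this formula. -/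
theorem diagEntry_diagOp (e b : OrthonormalBasis (Fin d) ℂ H) (v : Fin d → ℝ) (i : Fin d) :
    diagEntry e (diagOp b v) i = ∑ j, overlap e b i j * v j := by
  simp only [diagEntry, diagOp, overlap, sum_apply, inner_sum, Complex.re_sum]
  refine Finset.sum_congr rfl fun j _ => ?_
  rw [smul_apply, InnerProductSpace.rankOne_apply, inner_smul_right,
    inner_smul_right, ← inner_conj_symm (b j) (e i), mul_comm ((starRingEnd ℂ) _), RCLike.mul_conj,
    Complex.re_ofReal_mul, mul_comm]
  norm_cast

theorem diagEntry_nonneg (e : OrthonormalBasis (Fin d) ℂ H) {A : H →L[ℂ] H} (hA : A.IsPositive)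
    (i : Fin d) : 0 ≤ diagEntry e A i := by
  have := hA.re_inner_nonneg_right (e i)
  simpa [diagEntry] using this

theorem IsState.eigenvalue_nonneg {b : OrthonormalBasis (Fin d) ℂ H} {v : Fin d → ℝ}
    (h : IsState (diagOp b v)) (i : Fin d) : 0 ≤ v i := by
  have := diagEntry_nonneg b h.1 i
  rwa [diagEntry_diagOp_self] at this

theorem IsState.sum_diagEntry {A : H →L[ℂ] H} (h : IsState A)
    (e : OrthonormalBasis (Fin d) ℂ H) : ∑ i, diagEntry e A i = 1 := by
  rw [← reTrace_eq_sum_diagEntry e, reTrace, h.2, Complex.one_re]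

theorem IsState.sum_eigenvalue {b : OrthonormalBasis (Fin d) ℂ H} {v : Fin d → ℝ}
    (h : IsState (diagOp b v)) : ∑ i, v i = 1 := by
  rw [← h.sum_diagEntry b]
  simp [diagEntry_diagOp_self]

theorem spectrum_diagOp_subset (b : OrthonormalBasis (Fin d) ℂ H) (v : Fin d → ℝ) :
    spectrum ℝ (diagOp b v) ⊆ Set.range v := by
  intro x hx
  by_contra hne
  apply hx
  have hne' : ∀ i, x - v i ≠ 0 := fun i h => hne ⟨i, by linarith⟩
  have e1 : algebraMap ℝ (H →L[ℂ] H) x - diagOp b v = diagOp b (fun i => x - v i) := by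
    rw [← diagOp_const b, diagOp_sub]
  have e2 : diagOp b (fun _ => (1 : ℝ)) = 1 := by rw [diagOp_const, map_one]
  change IsUnit (algebraMap ℝ (H →L[ℂ] H) x - diagOp b v)
  rw [e1]
  refine ⟨⟨diagOp b (fun i => x - v i), diagOp b (fun i => (x - v i)⁻¹), ?_, ?_⟩, rfl⟩
  · rw [diagOp_mul, ← e2]; simp [hne']
  · rw [diagOp_mul, ← e2]; simp [hne']

theorem aeval_diagOp (b : OrthonormalBasis (Fin d) ℂ H) (v : Fin d → ℝ) (q : Polynomial ℝ) :
    Polynomial.aeval (diagOp b v) q = diagOp b (fun i => q.eval (v i)) := by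
  induction q using Polynomial.induction_on' with
  | add p q hp hq => simp [hp, hq, diagOp_add]
  | monomial n a =>
    rw [Polynomial.aeval_monomial, ← diagOp_const b]
    have hpow : diagOp b v ^ n = diagOp b (fun i => v i ^ n) := by
      induction n with
      | zero => simp [diagOp_const]
      | succ n ih => rw [pow_succ, ih, diagOp_mul]; simp [pow_succ]
    rw [hpow, diagOp_mul]
    simp

/-- The spectrum lies in the finite set of values of `v`, where `f` agrees with an interpolating
polynomial. No continuity of `f` is needed, which matters for the logarithm at `0`. -/
theorem cfc_diagOp [CompleteSpace H] (b : OrthonormalBasis (Fin d) ℂ H) (v : Fin d → ℝ)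
    (f : ℝ → ℝ) : cfc f (diagOp b v) = diagOp b (fun i => f (v i)) := by
  classical
  set q : Polynomial ℝ := Lagrange.interpolate (Finset.univ.image v) id f with hq
  have heval : ∀ i, q.eval (v i) = f (v i) := fun i =>
    Lagrange.eval_interpolate_at_node f (Function.injective_id.injOn)
      (Finset.mem_image_of_mem v (Finset.mem_univ i))
  have hcongr : (spectrum ℝ (diagOp b v)).EqOn f q.eval := by
    intro x hx
    obtain ⟨i, rfl⟩ := spectrum_diagOp_subset b v hx
    exact (heval i).symm
  rw [cfc_congr hcongr, cfc_polynomial q _ (diagOp_isSelfAdjoint b v), aeval_diagOp]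
  simp [heval]

theorem traceNorm_diagOp [CompleteSpace H] (b : OrthonormalBasis (Fin d) ℂ H) (v : Fin d → ℝ) :
    traceNorm (diagOp b v) = ∑ i, |v i| := by
  rw [traceNorm, CFC.abs_eq_cfc_norm _ (diagOp_isSelfAdjoint b v), cfc_diagOp, reTrace_diagOp]
  simp

theorem vonNeumannEntropy_diagOp [CompleteSpace H] (b : OrthonormalBasis (Fin d) ℂ H)
    (v : Fin d → ℝ) :
    vonNeumannEntropy (diagOp b v) = (∑ i, Real.negMulLog (v i)) / Real.log 2 := by
  rw [vonNeumannEntropy, cfc_diagOp, diagOp_mul, reTrace_diagOp, Finset.sum_div,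
    ← Finset.sum_neg_distrib]
  refine Finset.sum_congr rfl fun i _ => ?_
  rw [Real.negMulLog, Real.logb]
  ring

/-- Pinching does not increase the trace norm. -/
theorem sum_abs_diagEntry_le_traceNorm [CompleteSpace H] [FiniteDimensional ℂ H]
    (e : OrthonormalBasis (Fin d) ℂ H) {A : H →L[ℂ] H} (hA : IsSelfAdjoint A) :
    ∑ i, |diagEntry e A i| ≤ traceNorm A := by
  have hd : Module.finrank ℂ H = d := by
    simpa using Module.finrank_eq_card_basis e.toBasis
  obtain ⟨b, v, rfl⟩ := exists_eq_diagOp hd hA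
  rw [traceNorm_diagOp]
  calc ∑ i, |diagEntry e (diagOp b v) i| ≤ ∑ i, ∑ j, overlap e b i j * |v j| := by
        refine Finset.sum_le_sum fun i _ => ?_
        rw [diagEntry_diagOp]
        refine (Finset.abs_sum_le_sum_abs _ _).trans (Finset.sum_le_sum fun j _ => ?_)
        rw [abs_mul, abs_of_nonneg (overlap_nonneg e b i j)]
    _ = ∑ j, |v j| := by
        rw [Finset.sum_comm]
        simp [← Finset.sum_mul, sum_overlap_left]

/-- Pinching does not decrease the entropy. -/
theorem sum_negMulLog_le_diagEntry (e b : OrthonormalBasis (Fin d) ℂ H) {v : Fin d → ℝ}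
    (hv : ∀ i, 0 ≤ v i) :
    ∑ i, Real.negMulLog (v i) ≤ ∑ i, Real.negMulLog (diagEntry e (diagOp b v) i) := by
  -- Unit column sums of the overlaps give this rewriting; unit row sums then allow Jensen's
  -- inequality in each row.
  calc ∑ j, Real.negMulLog (v j) = ∑ i, ∑ j, overlap e b i j * Real.negMulLog (v j) := by
        rw [Finset.sum_comm]
        simp [← Finset.sum_mul, sum_overlap_left]
    _ ≤ _ := by
        refine Finset.sum_le_sum fun i _ => ?_
        rw [diagEntry_diagOp]
        exact Real.concaveOn_negMulLog.le_map_sum (fun j _ => overlap_nonneg e b i j)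
          (sum_overlap_right e b i) (fun j _ => hv j)

/-- The 2×2 minors of a rank-one matrix vanish, and here the off-diagonal entries are zero. -/
theorem IsPure.eigenvalue_mul_eigenvalue {b : OrthonormalBasis (Fin d) ℂ H} {v : Fin d → ℝ}
    (h : IsPure (diagOp b v)) {i j : Fin d} (hij : i ≠ j) : v i * v j = 0 := by
  obtain ⟨ψ, -, h⟩ := h
  have key : ∀ k l : Fin d, inner ℂ (b k) (diagOp b v (b l)) =
      inner ℂ ψ (b l) * inner ℂ (b k) ψ := by
    intro k l
    rw [h, InnerProductSpace.rankOne_apply, inner_smul_right]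
  have h1 : ∀ k l : Fin d, ((v l : ℝ) : ℂ) * (if k = l then 1 else 0) =
      inner ℂ ψ (b l) * inner ℂ (b k) ψ := by
    intro k l
    rw [← key, diagOp_apply_self, inner_smul_right, OrthonormalBasis.inner_eq_ite]
  have hi := h1 i i
  have hj := h1 j j
  have hx := h1 i j
  simp only [if_true, if_neg hij, mul_one, mul_zero] at hi hj hx
  have : ((v i * v j : ℝ) : ℂ) = 0 := by
    push_cast
    rw [hi, hj]
    linear_combination (- inner ℂ ψ (b i) * inner ℂ (b j) ψ) * hx
  exact_mod_cast this

theorem isPure_diagOp_single (b : OrthonormalBasis (Fin d) ℂ H) (j : Fin d) {v : Fin d → ℝ}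
    (hv : ∀ i, v i = if i = j then 1 else 0) : IsPure (diagOp b v) :=
  ⟨b j, b.norm_eq_one j, by rw [← diagOp_single]; congr 1; exact funext hv⟩

end Operators

/-! ### Gibbs' inequality, couplings and the classical Audenaert–Fannes bound. -/

section Classical

open Real

/-- This is `log t ≤ t - 1` at `t = y / x`. The correction `y - x` cancels when summed over vectors
of equal mass, so Gibbs' inequality and its equality case can be read off term by term. -/
theorem negMulLog_le_add {x y : ℝ} (hx : 0 ≤ x) (hy : 0 < y) :
    negMulLog x ≤ -(x * log y) + (y - x) := by
  rcases hx.eq_or_lt with rfl | hx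
  · simp [hy.le]
  have h := log_le_sub_one_of_pos (div_pos hy hx)
  rw [log_div hy.ne' hx.ne'] at h
  have h2 := mul_le_mul_of_nonneg_left h hx.le
  have h3 : x * (y / x - 1) = y - x := by field_simp
  rw [negMulLog]
  linarith

theorem eq_of_negMulLog_eq {x y : ℝ} (hx : 0 ≤ x) (hy : 0 < y)
    (h : negMulLog x = -(x * log y) + (y - x)) : x = y := by
  rcases hx.eq_or_lt with rfl | hx
  · simp at h; exact h
  by_contra hne
  have hne' : y / x ≠ 1 := fun h => hne ((div_eq_one_iff_eq hx.ne').1 h).symm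
  have h1 := log_lt_sub_one_of_pos (div_pos hy hx) hne'
  rw [log_div hy.ne' hx.ne'] at h1
  have h2 := mul_lt_mul_of_pos_left h1 hx
  have h3 : x * (y / x - 1) = y - x := by field_simp
  rw [negMulLog] at h
  linarith

theorem sum_negMulLog_le {ι : Type*} [Fintype ι] {p q : ι → ℝ} (hp : ∀ i, 0 ≤ p i)
    (hq : ∀ i, 0 < q i) (h : ∑ i, p i = ∑ i, q i) :
    ∑ i, negMulLog (p i) ≤ ∑ i, -(p i * log (q i)) := by
  calc ∑ i, negMulLog (p i) ≤ ∑ i, (-(p i * log (q i)) + (q i - p i)) :=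
        Finset.sum_le_sum fun i _ => negMulLog_le_add (hp i) (hq i)
    _ = _ := by rw [Finset.sum_add_distrib, Finset.sum_sub_distrib, h]; ring

theorem eq_of_sum_negMulLog_eq {ι : Type*} [Fintype ι] {p q : ι → ℝ} (hp : ∀ i, 0 ≤ p i)
    (hq : ∀ i, 0 < q i) (h : ∑ i, p i = ∑ i, q i)
    (he : ∑ i, negMulLog (p i) = ∑ i, -(p i * log (q i))) (i : ι) : p i = q i := by
  have he' : ∑ i, negMulLog (p i) = ∑ i, (-(p i * log (q i)) + (q i - p i)) := by
    rw [Finset.sum_add_distrib, Finset.sum_sub_distrib, h, he]; ring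
  exact eq_of_negMulLog_eq (hp i) (hq i)
    ((Finset.sum_eq_sum_iff_of_le fun i _ => negMulLog_le_add (hp i) (hq i)).1 he' i
      (Finset.mem_univ i))

variable {d : ℕ}

theorem sum_inv_card (hd : 0 < d) : ∑ _i : Fin d, 1 / (d : ℝ) = 1 := by
  have : (d : ℝ) ≠ 0 := by positivity
  simp [this]

theorem sum_negMulLog_le_log {p : Fin d → ℝ} (hd : 0 < d) (hp : ∀ i, 0 ≤ p i)
    (h1 : ∑ i, p i = 1) : ∑ i, negMulLog (p i) ≤ log d := by
  have hd' : (0 : ℝ) < d := by exact_mod_cast hd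
  have := sum_negMulLog_le (q := fun _ => 1 / (d : ℝ)) hp (fun _ => by positivity)
    (by rw [h1, sum_inv_card hd])
  refine this.trans_eq ?_
  simp [← Finset.sum_mul, h1]

theorem eq_of_sum_negMulLog_eq_log {p : Fin d → ℝ} (hd : 0 < d) (hp : ∀ i, 0 ≤ p i)
    (h1 : ∑ i, p i = 1) (h : ∑ i, negMulLog (p i) = log d) (i : Fin d) : p i = 1 / d := by
  have hd' : (0 : ℝ) < d := by exact_mod_cast hd
  refine eq_of_sum_negMulLog_eq (q := fun _ => 1 / (d : ℝ)) hp (fun _ => by positivity)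
    (by rw [h1, sum_inv_card hd]) ?_ i
  rw [h]
  simp [← Finset.sum_mul, h1]

theorem sum_negMulLog_const (hd : 0 < d) : ∑ _i : Fin d, negMulLog (1 / (d : ℝ)) = log d := by
  have hd' : (d : ℝ) ≠ 0 := by positivity
  simp [negMulLog, hd']

theorem le_one_of_sum_eq_one {p : Fin d → ℝ} (hp : ∀ i, 0 ≤ p i) (h1 : ∑ i, p i = 1) (i : Fin d) :
    p i ≤ 1 := by
  rw [← h1]; exact Finset.single_le_sum (fun i _ => hp i) (Finset.mem_univ i)

theorem sum_negMulLog_nonneg {p : Fin d → ℝ} (hp : ∀ i, 0 ≤ p i) (h1 : ∑ i, p i = 1) :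
    0 ≤ ∑ i, negMulLog (p i) :=
  Finset.sum_nonneg fun i _ => negMulLog_nonneg (hp i) (le_one_of_sum_eq_one hp h1 i)

theorem exists_eq_single_of_zero_or_one {p : Fin d → ℝ} (h1 : ∑ i, p i = 1)
    (h : ∀ i, p i = 0 ∨ p i = 1) : ∃ j, ∀ i, p i = if i = j then 1 else 0 := by
  have hp : ∀ i, 0 ≤ p i := fun i => by rcases h i with h | h <;> simp [h]
  obtain ⟨j, hj⟩ : ∃ j, p j = 1 := by
    by_contra! hne
    have : ∀ i, p i = 0 := fun i => (h i).resolve_right (hne i)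
    simp [this] at h1
  refine ⟨j, fun i => ?_⟩
  split_ifs with hij
  · rw [hij, hj]
  · refine (h i).resolve_right fun hi => ?_
    have := Finset.add_le_sum (fun i _ => hp i) (Finset.mem_univ i) (Finset.mem_univ j) hij
    linarith

theorem exists_eq_single_of_sum_negMulLog_eq_zero {p : Fin d → ℝ} (hp : ∀ i, 0 ≤ p i)
    (h1 : ∑ i, p i = 1) (h : ∑ i, negMulLog (p i) = 0) :
    ∃ j, ∀ i, p i = if i = j then 1 else 0 := by
  refine exists_eq_single_of_zero_or_one h1 fun i => ?_
  have hi := (Finset.sum_eq_zero_iff_of_nonneg fun i _ =>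
    negMulLog_nonneg (hp i) (le_one_of_sum_eq_one hp h1 i)).1 h i (Finset.mem_univ i)
  rw [negMulLog] at hi
  rcases mul_eq_zero.1 hi with h0 | h0
  · left; linarith
  · rcases log_eq_zero.1 h0 with h0 | h0 | h0
    · exact Or.inl h0
    · exact Or.inr h0
    · have := hp i; linarith

/-- A coupling of two probability vectors which puts weight `δ`, their distance, off the
diagonal. -/
theorem exists_coupling {p q : Fin d → ℝ} (hp : ∀ i, 0 ≤ p i) (hq : ∀ i, 0 ≤ q i)
    (hpq : ∑ i, p i = ∑ i, q i) :
    ∃ γ : Fin d → Fin d → ℝ, (∀ x y, 0 ≤ γ x y) ∧ (∀ x, ∑ y, γ x y = p x) ∧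
      (∀ y, ∑ x, γ x y = q y) ∧
      ∑ x, ∑ y, (if x = y then 0 else γ x y) ≤ (∑ i, |p i - q i|) / 2 := by
  set δ : ℝ := ∑ i, max (p i - q i) 0 with hδ
  have hδ' : δ = ∑ i, max (q i - p i) 0 := by
    rw [hδ, ← sub_eq_zero, ← Finset.sum_sub_distrib]
    have : ∀ i, max (p i - q i) 0 - max (q i - p i) 0 = p i - q i := by
      intro i
      rcases le_total (p i) (q i) with h | h
      · rw [max_eq_right (by linarith), max_eq_left (by linarith)]; ring
      · rw [max_eq_left (by linarith), max_eq_right (by linarith)]; ring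
    simp [this, hpq]
  have hδ2 : (∑ i, |p i - q i|) / 2 = δ := by
    have : ∑ i, |p i - q i| = δ + δ := by
      nth_rewrite 2 [hδ']
      rw [hδ, ← Finset.sum_add_distrib]
      refine Finset.sum_congr rfl fun i _ => ?_
      rcases le_total (p i) (q i) with h | h
      · rw [max_eq_right (by linarith), max_eq_left (by linarith), abs_of_nonpos (by linarith)]
        ring
      · rw [max_eq_left (by linarith), max_eq_right (by linarith), abs_of_nonneg (by linarith)]
        ring
    linarith
  have hδ0 : 0 ≤ δ := Finset.sum_nonneg fun i _ => le_max_right _ _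
  -- If `δ = 0`, division by `δ` returns `0`, which is correct because `f` then vanishes.
  have hmul : ∀ f : Fin d → ℝ, (∀ i, 0 ≤ f i) → δ = ∑ i, f i → ∀ i, f i * δ / δ = f i := by
    intro f hf hs i
    rcases hδ0.eq_or_lt with h | h
    · have : f i = 0 := (Finset.sum_eq_zero_iff_of_nonneg fun i _ => hf i).1
        (hs ▸ h.symm) i (Finset.mem_univ i)
      simp [this]
    · field_simp
  have hmin : ∀ i, min (p i) (q i) + max (p i - q i) 0 = p i := by
    intro i
    rcases le_total (p i) (q i) with h | h
    · rw [max_eq_right (by linarith), min_eq_left h]; ring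
    · rw [max_eq_left (by linarith), min_eq_right h]; ring
  have hmin' : ∀ i, min (p i) (q i) + max (q i - p i) 0 = q i := by
    intro i
    rcases le_total (p i) (q i) with h | h
    · rw [max_eq_left (by linarith), min_eq_left h]; ring
    · rw [max_eq_right (by linarith), min_eq_right h]; ring
  -- The common mass `min p q` stays in place, and the surplus of `p` is distributed over the
  -- deficits proportionally to their size.
  refine ⟨fun x y => (if x = y then min (p x) (q x) else 0) +
    max (p x - q x) 0 * max (q y - p y) 0 / δ, ?_, ?_, ?_, ?_⟩
  · intro x y
    have h1 : 0 ≤ min (p x) (q x) := le_min (hp x) (hq x)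
    have h2 : 0 ≤ max (p x - q x) 0 * max (q y - p y) 0 / δ := by positivity
    change 0 ≤ (if x = y then min (p x) (q x) else 0) + _
    split_ifs <;> linarith
  · intro x
    rw [Finset.sum_add_distrib, ← Finset.sum_div, ← Finset.mul_sum, ← hδ',
      hmul (fun i => max (p i - q i) 0) (fun i => le_max_right _ _) hδ x]
    simp [hmin]
  · intro y
    rw [Finset.sum_add_distrib, ← Finset.sum_div, ← Finset.sum_mul, ← hδ, mul_comm δ,
      hmul (fun i => max (q i - p i) 0) (fun i => le_max_right _ _) hδ' y]
    simp [hmin']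
  · rw [hδ2]
    calc _ ≤ ∑ x, ∑ y, max (p x - q x) 0 * max (q y - p y) 0 / δ := by
          refine Finset.sum_le_sum fun x _ => Finset.sum_le_sum fun y _ => ?_
          have h2 : 0 ≤ max (p x - q x) 0 * max (q y - p y) 0 / δ := by positivity
          by_cases h : x = y
          · simp only [if_pos h]; exact h2
          · simp only [if_neg h, zero_add]; exact le_rfl
      _ = δ := by
          simp only [← Finset.sum_div, ← Finset.mul_sum, ← Finset.sum_mul]
          rw [← hδ, ← hδ']
          rcases hδ0.eq_or_lt with h | h
          · simp [← h]
          · field_simp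

/-- The natural-logarithm form of the Fannes–Audenaert right-hand side `ε log (d-1) + h(ε)`. -/
noncomputable def fannesNat (d : ℕ) (ε : ℝ) : ℝ :=
  -((1 - ε) * log (1 - ε)) - ε * log (ε / ((d : ℝ) - 1))

/-- The transition matrix that stays with probability `1 - ε` and moves uniformly otherwise. -/
noncomputable def spikeKernel (d : ℕ) (ε : ℝ) (x y : Fin d) : ℝ :=
  if x = y then 1 - ε else ε / ((d : ℝ) - 1)

theorem sum_ite_eq_card (y : Fin d) (a c : ℝ) :
    ∑ x, (if x = y then a else c) = a + ((d : ℝ) - 1) * c := by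
  have : ∀ x, (if x = y then a else c) = (if x = y then a - c else 0) + c := by
    intro x; split_ifs <;> ring
  simp only [this, Finset.sum_add_distrib]
  simp
  ring

theorem sum_spikeKernel (hd : 1 < d) (ε : ℝ) (y : Fin d) : ∑ x, spikeKernel d ε x y = 1 := by
  have hd' : (1 : ℝ) < d := by exact_mod_cast hd
  have : (d : ℝ) - 1 ≠ 0 := by linarith
  unfold spikeKernel
  rw [sum_ite_eq_card]
  field_simp
  ring

theorem sum_negMulLog_spikeKernel (hd : 1 < d) (ε : ℝ) (y : Fin d) :
    ∑ x, negMulLog (spikeKernel d ε x y) = fannesNat d ε := by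
  have hd' : (1 : ℝ) < d := by exact_mod_cast hd
  have : (d : ℝ) - 1 ≠ 0 := by linarith
  unfold spikeKernel fannesNat
  simp only [apply_ite negMulLog]
  rw [sum_ite_eq_card]
  simp only [negMulLog]
  field_simp
  ring

/-- Pointwise bound behind the Audenaert–Fannes inequality for a coupling. -/
theorem coupling_term_le {w p q r : ℝ} (hw : 0 ≤ w) (hwp : w ≤ p) (hwq : w ≤ q) (hr : 0 < r) :
    w * log q - w * log p ≤ -(w * log r) + (q * r - w) := by
  rcases hw.eq_or_lt with rfl | hw
  · simp; positivity
  have hp : 0 < p := hw.trans_le hwp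
  have hq : 0 < q := hw.trans_le hwq
  -- Two estimates are combined: Gibbs for `w` against `q * r`, and `log w ≤ log p`.
  have h1 := negMulLog_le_add hw.le (mul_pos hq hr)
  have h2 := log_le_log hw hwp
  rw [negMulLog, log_mul hq.ne' hr.ne'] at h1
  nlinarith

/-- Both estimates behind `coupling_term_le` must be tight; the second one says nothing when `w =
0`. -/
theorem coupling_term_eq {w p q r : ℝ} (hw : 0 ≤ w) (hwp : w ≤ p) (hwq : w ≤ q) (hr : 0 < r)
    (h : w * log q - w * log p = -(w * log r) + (q * r - w)) : w = q * r ∧ (w = 0 ∨ w = p) := by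
  rcases hw.eq_or_lt with rfl | hw
  · simp at h
    simp [h]
  have hp : 0 < p := hw.trans_le hwp
  have hq : 0 < q := hw.trans_le hwq
  have h1 := negMulLog_le_add hw.le (mul_pos hq hr)
  have h2 := mul_le_mul_of_nonneg_left (log_le_log hw hwp) hw.le
  have h3 : negMulLog w = -(w * log (q * r)) + (q * r - w) := by
    refine le_antisymm h1 ?_
    rw [negMulLog, log_mul hq.ne' hr.ne']
    nlinarith
  refine ⟨eq_of_negMulLog_eq hw.le (mul_pos hq hr) h3, Or.inr ?_⟩
  rw [negMulLog, log_mul hq.ne' hr.ne'] at h3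
  have h4 : w * log w = w * log p := by linarith
  exact log_injOn_pos (Set.mem_Ioi.2 hw) (Set.mem_Ioi.2 hp) (mul_left_cancel₀ hw.ne' h4)

/-- The role of the threshold `1 - 1/d`: below it, staying is strictly likelier than each single
move of the spike kernel. -/
theorem lt_sub_div_card {ε : ℝ} (hd : 1 < d) (hε : ε < 1 - 1 / (d : ℝ)) :
    ε / ((d : ℝ) - 1) < 1 - ε := by
  have hd' : (1 : ℝ) < d := by exact_mod_cast hd
  rw [div_lt_iff₀ (by linarith)]
  have h2 : ε * d < d - 1 := by
    have := mul_lt_mul_of_pos_right hε (by linarith : (0 : ℝ) < d)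
    rwa [sub_mul, one_mul, one_div_mul_cancel (by linarith)] at this
  linarith

theorem one_lt_of_lt_one_sub {ε : ℝ} (hd : 0 < d) (hε : 0 < ε) (hεd : ε < 1 - 1 / (d : ℝ)) :
    1 < d := by
  by_contra! h
  obtain rfl : d = 1 := by omega
  simp at hεd
  linarith

/-- The classical Audenaert–Fannes inequality, with its case of equality. -/
theorem audenaertFannes_classical {p q : Fin d → ℝ} {ε : ℝ} (hd : 1 < d) (hε : 0 < ε)
    (hεd : ε < 1 - 1 / (d : ℝ)) (hp : ∀ i, 0 ≤ p i) (hq : ∀ i, 0 ≤ q i) (hp1 : ∑ i, p i = 1)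
    (hq1 : ∑ i, q i = 1) (hpq : (∑ i, |p i - q i|) / 2 ≤ ε) :
    ∑ i, negMulLog (p i) - ∑ i, negMulLog (q i) ≤ fannesNat d ε ∧
    (∑ i, negMulLog (p i) - ∑ i, negMulLog (q i) = fannesNat d ε →
      ∃ j, (∀ i, q i = if i = j then 1 else 0) ∧ ∀ i, p i = spikeKernel d ε i j) := by
  obtain ⟨γ, hγ0, hγp, hγq, hγδ⟩ := exists_coupling hp hq (hp1.trans hq1.symm)
  set r := spikeKernel d ε with hr
  have hd' : (1 : ℝ) < d := by exact_mod_cast hd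
  have hlt := lt_sub_div_card hd hεd
  have hc : 0 < ε / ((d : ℝ) - 1) := div_pos hε (by linarith)
  have hr0 : ∀ x y, 0 < r x y := by
    intro x y; rw [hr]; unfold spikeKernel; split_ifs <;> linarith
  have hle1 : ∀ x y, γ x y ≤ p x := fun x y => by
    rw [← hγp x]; exact Finset.single_le_sum (fun y _ => hγ0 x y) (Finset.mem_univ y)
  have hle2 : ∀ x y, γ x y ≤ q y := fun x y => by
    rw [← hγq y]; exact Finset.single_le_sum (fun x _ => hγ0 x y) (Finset.mem_univ x)
  have hL : ∑ i, negMulLog (p i) - ∑ i, negMulLog (q i) =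
      ∑ x, ∑ y, (γ x y * log (q y) - γ x y * log (p x)) := by
    simp only [Finset.sum_sub_distrib, ← Finset.sum_mul, hγp]
    rw [Finset.sum_comm (f := fun x y => γ x y * log (q y))]
    simp only [← Finset.sum_mul, hγq, negMulLog, neg_mul, Finset.sum_neg_distrib]
    ring
  have htot : ∑ x, ∑ y, γ x y = 1 := by simp only [hγp, hp1]
  -- Since `log r` takes only two values, the coupling enters this sum only through its off-diagonal
  -- mass; the positive slope `hlog` then allows replacing that mass by `ε`.
  have hR : ∑ x, ∑ y, (-(γ x y * log (r x y)) + (q y * r x y - γ x y)) =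
      -log (1 - ε) + (∑ x, ∑ y, if x = y then 0 else γ x y) *
        (log (1 - ε) - log (ε / ((d : ℝ) - 1))) := by
    have h1 : ∑ x, ∑ y, q y * r x y = 1 := by
      rw [Finset.sum_comm]
      simp only [← Finset.mul_sum, hr, sum_spikeKernel hd, mul_one, hq1]
    have h2 : ∀ x y, -(γ x y * log (r x y)) = -(γ x y * log (1 - ε)) +
        (if x = y then 0 else γ x y) * (log (1 - ε) - log (ε / ((d : ℝ) - 1))) := by
      intro x y
      rw [hr]; unfold spikeKernel
      split_ifs <;> ring
    simp only [Finset.sum_add_distrib, Finset.sum_sub_distrib, h1, htot, h2, ← Finset.sum_mul,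
      Finset.sum_neg_distrib]
    ring
  have hlog : 0 < log (1 - ε) - log (ε / ((d : ℝ) - 1)) := sub_pos.2 (log_lt_log hc hlt)
  have hF : fannesNat d ε = -log (1 - ε) + ε * (log (1 - ε) - log (ε / ((d : ℝ) - 1))) := by
    unfold fannesNat; ring
  have hterm : ∀ x y, γ x y * log (q y) - γ x y * log (p x) ≤
      -(γ x y * log (r x y)) + (q y * r x y - γ x y) := fun x y =>
    coupling_term_le (hγ0 x y) (hle1 x y) (hle2 x y) (hr0 x y)
  have hLR := Finset.sum_le_sum fun x (_ : x ∈ Finset.univ) =>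
    Finset.sum_le_sum fun y (_ : y ∈ Finset.univ) => hterm x y
  have hRF := mul_le_mul_of_nonneg_right (hγδ.trans hpq) hlog.le
  refine ⟨by rw [hL, hF]; linarith, fun heq => ?_⟩
  have heq2 : ∑ x, ∑ y, (γ x y * log (q y) - γ x y * log (p x)) =
      ∑ x, ∑ y, (-(γ x y * log (r x y)) + (q y * r x y - γ x y)) := by
    refine le_antisymm hLR ?_
    rw [← hL, heq, hF, hR]; linarith
  have hxy : ∀ x y, γ x y = q y * r x y ∧ (γ x y = 0 ∨ γ x y = p x) := by
    intro x y
    have h1 := (Finset.sum_eq_sum_iff_of_le fun x _ =>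
      Finset.sum_le_sum fun y (_ : y ∈ Finset.univ) => hterm x y).1 heq2 x (Finset.mem_univ x)
    have h2 := (Finset.sum_eq_sum_iff_of_le fun y _ => hterm x y).1 h1 y (Finset.mem_univ y)
    exact coupling_term_eq (hγ0 x y) (hle1 x y) (hle2 x y) (hr0 x y) h2
  -- As `r` is positive, column `j` of `γ` has no zero and so equals `p` in every row. It exhausts
  -- each row marginal and leaves nothing for the other columns.
  obtain ⟨j, hj⟩ : ∃ j, q j ≠ 0 := by
    by_contra! hne
    simp [hne] at hq1
  have hpj : ∀ x, γ x j = p x := fun x => (hxy x j).2.resolve_left (by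
    rw [(hxy x j).1]; exact mul_ne_zero hj (hr0 x j).ne')
  have hother : ∀ y, y ≠ j → q y = 0 := by
    intro y hy
    have h1 := Finset.add_le_sum (fun i _ => hγ0 j i) (Finset.mem_univ y) (Finset.mem_univ j) hy
    rw [hγp, hpj] at h1
    have h2 : γ j y = 0 := le_antisymm (by linarith) (hγ0 j y)
    rw [(hxy j y).1] at h2
    exact (mul_eq_zero.1 h2).resolve_right (hr0 j y).ne'
  have hqj : q j = 1 := by
    rw [← hq1, Finset.sum_eq_single j (fun y _ hy => hother y hy) (by simp)]
  refine ⟨j, fun i => ?_, fun i => ?_⟩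
  · split_ifs with h
    · rw [h, hqj]
    · exact hother i h
  · rw [← hpj, (hxy i j).1, hqj, one_mul]

end Classical

/-! ### Abel summation, Schur concavity and Ky Fan's bound. -/

section Majorization

open Real

/-- Abel summation: passing from `c n` to the smaller `c (n + 1)` only decreases the multiple of a
nonnegative partial sum. -/
theorem le_sum_range_mul_of_antitone {z c : ℕ → ℝ} (hc : Antitone c) (n : ℕ)
    (hz : ∀ k ≤ n, 0 ≤ ∑ i ∈ Finset.range k, z i) :
    c n * ∑ i ∈ Finset.range n, z i ≤ ∑ i ∈ Finset.range n, z i * c i := by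
  induction n with
  | zero => simp
  | succ n ih =>
    have h1 := ih fun k hk => hz k (by omega)
    have h2 := mul_le_mul_of_nonneg_right (hc n.le_succ) (hz (n + 1) le_rfl)
    rw [Finset.sum_range_succ] at h2 ⊢
    rw [Finset.sum_range_succ]
    simp only [Nat.succ_eq_add_one] at h2
    linarith

variable {d : ℕ}

theorem sum_mul_nonneg_of_antitone {z c : Fin d → ℝ} (hc : Antitone c)
    (hz : ∀ k : ℕ, 0 ≤ ∑ i with (i : Fin d).val < k, z i) (hz0 : ∑ i, z i = 0) :
    0 ≤ ∑ i, z i * c i := by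
  rcases Nat.eq_zero_or_pos d with rfl | hd
  · simp
  set z' : ℕ → ℝ := fun k => if h : k < d then z ⟨k, h⟩ else 0 with hz'
  set c' : ℕ → ℝ := fun k => c ⟨min k (d - 1), by omega⟩ with hc'
  have hz1 : ∀ i : Fin d, z' i = z i := fun i => by simp [hz']
  have hc1 : ∀ i : Fin d, c' i = c i := fun i => by
    simp only [hc']
    congr 1
    ext
    simp only []
    omega
  have hanti : Antitone c' := fun k l hkl => hc (by
    change min k (d - 1) ≤ min l (d - 1)
    omega)
  have hpre : ∀ k ≤ d, ∑ i ∈ Finset.range k, z' i = ∑ i with (i : Fin d).val < k, z i := by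
    intro k hk
    have h1 : Finset.range k = (Finset.range d).filter (· < k) := by ext; simp; omega
    rw [h1, Finset.sum_filter, Finset.sum_range, Finset.sum_filter]
    simp only [hz1]
  have h := le_sum_range_mul_of_antitone hanti d fun k hk => by rw [hpre k hk]; exact hz k
  rw [Finset.sum_range, Finset.sum_range] at h
  simpa only [hz1, hc1, hz0, mul_zero] using h

theorem prefix_eq_sum {s : Fin d → ℝ} {k : ℕ} (hs : ∀ i : Fin d, k ≤ i.val → s i = 0) :
    ∑ i with (i : Fin d).val < k, s i = ∑ i, s i := by
  rw [Finset.sum_filter]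
  refine Finset.sum_congr rfl fun i _ => ?_
  split_ifs with h
  · rfl
  · exact (hs i (by omega)).symm

/-- Schur concavity of the Shannon entropy. -/
theorem sum_negMulLog_le_of_prefix_le {p q : Fin d → ℝ} (hp : ∀ i, 0 ≤ p i) (hq : ∀ i, 0 ≤ q i)
    (hp1 : ∑ i, p i = 1) (hq1 : ∑ i, q i = 1) (hanti : Antitone p)
    (hpq : ∀ k : ℕ, ∑ i with (i : Fin d).val < k, p i ≤ ∑ i with (i : Fin d).val < k, q i) :
    ∑ i, negMulLog (q i) ≤ ∑ i, negMulLog (p i) := by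
  -- `m` is the least nonzero entry of `p`. Cutting off at `m` below keeps the logarithms antitone,
  -- which the convention `log 0 = 0` would destroy.
  obtain ⟨m, hm0, hm⟩ : ∃ m : ℝ, 0 < m ∧ ∀ i, p i ≠ 0 → m ≤ p i := by
    have hne : (Finset.univ.filter fun i => p i ≠ 0).Nonempty := by
      by_contra h
      have : ∀ i, p i = 0 := by simpa [Finset.filter_eq_empty_iff] using h
      simp [this] at hp1
    obtain ⟨i, hi, him⟩ := Finset.exists_min_image _ p hne
    refine ⟨p i, lt_of_le_of_ne (hp i) (Finset.mem_filter.1 hi).2.symm, fun j hj => ?_⟩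
    exact him j (Finset.mem_filter.2 ⟨Finset.mem_univ j, hj⟩)
  -- If `p i = 0`, the entries of `p` before `i` already carry all the mass, hence so do those of
  -- `q`.
  have hsupp : ∀ i, p i = 0 → q i = 0 := by
    intro i hi
    have h1 := hpq i.val
    rw [prefix_eq_sum fun j hj => le_antisymm (hi ▸ hanti hj) (hp j), hp1] at h1
    have h2 : ∑ j with (j : Fin d).val < i.val, q j + q i ≤ ∑ j, q j := by
      have h3 : i ∉ Finset.univ.filter (fun j : Fin d => j.val < i.val) := by simp
      rw [add_comm, ← Finset.sum_insert h3]
      exact Finset.sum_le_sum_of_subset_of_nonneg (Finset.subset_univ _) fun j _ _ => hq j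
    have := hq i
    linarith
  set c : Fin d → ℝ := fun i => log (max (p i) m) with hc
  have hcanti : Antitone c := fun i j hij =>
    log_le_log (lt_of_lt_of_le hm0 (le_max_right _ _)) (max_le_max_right m (hanti hij))
  have hcp : ∀ i, p i ≠ 0 → c i = log (p i) := fun i hi => by simp [hc, max_eq_left (hm i hi)]
  have hterm : ∀ i, negMulLog (q i) ≤ -(q i * c i) + (p i - q i) := by
    intro i
    by_cases hi : p i = 0
    · simp [hi, hsupp i hi]
    · rw [hcp i hi]
      exact negMulLog_le_add (hq i) (lt_of_le_of_ne (hp i) (Ne.symm hi))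
  have hpc : ∀ i, negMulLog (p i) = -(p i * c i) := by
    intro i
    by_cases hi : p i = 0
    · simp [hi]
    · rw [hcp i hi, negMulLog]; ring
  have hab := sum_mul_nonneg_of_antitone (z := fun i => q i - p i) hcanti
    (fun k => by rw [Finset.sum_sub_distrib]; linarith [hpq k])
    (by rw [Finset.sum_sub_distrib, hp1, hq1, sub_self])
  calc ∑ i, negMulLog (q i) ≤ ∑ i, (-(q i * c i) + (p i - q i)) :=
        Finset.sum_le_sum fun i _ => hterm i
    _ = -∑ i, q i * c i := by
        rw [Finset.sum_add_distrib, Finset.sum_sub_distrib, hp1, hq1, Finset.sum_neg_distrib]; ring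
    _ ≤ ∑ i, negMulLog (p i) := by
        simp only [hpc, Finset.sum_neg_distrib]
        simp only [sub_mul, Finset.sum_sub_distrib] at hab
        linarith

theorem sum_weight_mul_le_prefix {w v : Fin d → ℝ} (hv : Antitone v) (k : ℕ) (hw0 : ∀ i, 0 ≤ w i)
    (hw1 : ∀ i, w i ≤ 1) (hw : ∑ i, w i = ∑ i with (i : Fin d).val < k, (1 : ℝ)) :
    ∑ i, w i * v i ≤ ∑ i with (i : Fin d).val < k, v i := by
  rcases Nat.eq_zero_or_pos d with rfl | hd
  · simp
  -- The threshold is the `k`-th largest value: moving weight into the first `k` places across `t`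
  -- can only help. The truncations cover `k = 0` and `k > d`.
  set t : ℝ := v ⟨min (k - 1) (d - 1), by omega⟩ with ht
  have hterm : ∀ i : Fin d,
      (w i - if i.val < k then 1 else 0) * v i ≤ (w i - if i.val < k then 1 else 0) * t := by
    intro i
    split_ifs with h
    · have : t ≤ v i := hv (by change i.val ≤ min (k - 1) (d - 1); omega)
      nlinarith [hw1 i]
    · have : v i ≤ t := hv (by change min (k - 1) (d - 1) ≤ i.val; omega)
      nlinarith [hw0 i]
  have hsum := Finset.sum_le_sum fun i (_ : i ∈ Finset.univ) => hterm i
  rw [← Finset.sum_mul, Finset.sum_sub_distrib, hw, Finset.sum_filter, sub_self, zero_mul] at hsum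
  simp only [sub_mul, Finset.sum_sub_distrib, ite_mul, one_mul, zero_mul] at hsum
  rw [Finset.sum_filter]
  linarith

/-- A partial sum is at most the sum of the positive parts, which is half the `ℓ¹` norm when the
total is zero. -/
theorem prefix_le_half_sum_abs {x : Fin d → ℝ} (hx : ∑ i, x i = 0) (k : ℕ) :
    ∑ i with (i : Fin d).val < k, x i ≤ (∑ i, |x i|) / 2 := by
  have h : ∑ i with (i : Fin d).val < k, x i ≤ ∑ i, (x i + |x i|) / 2 := by
    rw [Finset.sum_filter]
    refine Finset.sum_le_sum fun i _ => ?_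
    have h1 := le_abs_self (x i)
    have h2 := neg_abs_le (x i)
    split_ifs <;> linarith
  rw [← Finset.sum_div, Finset.sum_add_distrib, hx, zero_add] at h
  exact h

/-- Ky Fan's bound: the eigenvalue sums of nearby states are close. -/
theorem prefix_eigenvalue_le {H : Type*} [NormedAddCommGroup H] [InnerProductSpace ℂ H]
    [CompleteSpace H] [FiniteDimensional ℂ H] {b e : OrthonormalBasis (Fin d) ℂ H}
    {v w : Fin d → ℝ} (hv : Antitone v) (hσ : IsState (diagOp b v)) (hω : IsState (diagOp e w))
    (k : ℕ) :
    ∑ i with (i : Fin d).val < k, w i ≤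
      ∑ i with (i : Fin d).val < k, v i + traceNorm (diagOp e w - diagOp b v) / 2 := by
  have h1 : ∑ i with (i : Fin d).val < k, diagEntry e (diagOp e w - diagOp b v) i ≤
      traceNorm (diagOp e w - diagOp b v) / 2 := by
    refine (prefix_le_half_sum_abs ?_ k).trans ?_
    · simp only [diagEntry_sub, Finset.sum_sub_distrib, hσ.sum_diagEntry, hω.sum_diagEntry,
        sub_self]
    · have := sum_abs_diagEntry_le_traceNorm e
        ((diagOp_isSelfAdjoint e w).sub (diagOp_isSelfAdjoint b v))
      linarith
  -- Summing the selected rows of overlaps gives each eigenvalue a weight in `[0, 1]`, with total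
  -- weight the number of rows.
  have h2 : ∑ i with (i : Fin d).val < k, diagEntry e (diagOp b v) i ≤
      ∑ i with (i : Fin d).val < k, v i := by
    simp only [diagEntry_diagOp]
    rw [Finset.sum_comm]
    simp only [← Finset.sum_mul]
    refine sum_weight_mul_le_prefix hv k
      (fun j => Finset.sum_nonneg fun i _ => overlap_nonneg e b i j) (fun j => ?_) ?_
    · rw [← sum_overlap_left e b j]
      exact Finset.sum_le_sum_of_subset_of_nonneg (Finset.filter_subset _ _)
        fun i _ _ => overlap_nonneg e b i j
    · rw [Finset.sum_comm]
      simp only [sum_overlap_right]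
  simp only [diagEntry_sub, Finset.sum_sub_distrib, diagEntry_diagOp_self] at h1
  linarith

end Majorization

/-! ### The entropy-minimizing vector. -/

section Steepened

variable {d : ℕ} {μ : Fin d → ℝ} {ε : ℝ}

theorem tailIndex_le : tailIndex μ ε ≤ d - 1 := Nat.findGreatest_le _

theorem tailSum_tailIndex_le (hε : 0 ≤ ε) : tailSum μ (tailIndex μ ε) ≤ ε := by
  classical
  refine Nat.findGreatest_spec (P := fun l => tailSum μ l ≤ ε) (Nat.zero_le _) ?_
  have : tailSum μ 0 = 0 := by
    refine Finset.sum_eq_zero fun i hi => ?_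
    simp at hi
    omega
  rw [this]; exact hε

theorem lt_tailSum_of_tailIndex_lt {l : ℕ} (h1 : tailIndex μ ε < l) (h2 : l ≤ d - 1) :
    ε < tailSum μ l := by
  classical
  exact not_le.1 (Nat.findGreatest_is_greatest h1 h2)

theorem tailSum_succ {l : ℕ} (i : Fin d) (hi : i.val + 1 + l = d) :
    tailSum μ (l + 1) = μ i + tailSum μ l := by
  unfold tailSum
  rw [← Finset.sum_insert (a := i) (by simp; omega)]
  congr 1
  ext j
  simp only [Finset.mem_filter, Finset.mem_univ, true_and, Finset.mem_insert, Fin.ext_iff]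
  omega

theorem head_add_tailSum (z : Fin d) (hz : z.val = 0) : μ z + tailSum μ (d - 1) = ∑ i, μ i := by
  unfold tailSum
  rw [← Finset.sum_insert (a := z) (by simp; omega)]
  congr 1
  ext j
  simp only [Finset.mem_filter, Finset.mem_univ, true_and, Finset.mem_insert, Fin.ext_iff, iff_true]
  omega

theorem steepened_eq_single (h : tailIndex μ ε + 1 = d) (z : Fin d) (hz : z.val = 0) (i : Fin d) :
    steepened μ ε i = if i = z then 1 else 0 := by
  simp [steepened, h, Fin.ext_iff, hz]

/-- The additive form splits each sum into the gain at the head, the loss at `k`, and the erased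
tail. -/
theorem steepened_eq_add (h : tailIndex μ ε + 1 < d) (z k : Fin d) (hz : z.val = 0)
    (hk : k.val + 1 + tailIndex μ ε = d) (i : Fin d) :
    steepened μ ε i = μ i + (if i = z then ε else 0)
      - (if i = k then ε - tailSum μ (tailIndex μ ε) else 0)
      - (if d ≤ i.val + tailIndex μ ε then μ i else 0) := by
  simp only [steepened, if_neg h.ne, Fin.ext_iff, hz]
  by_cases h0 : i.val = 0
  · rw [if_pos h0, if_pos h0, if_neg (by omega), if_neg (by omega)]; ring
  rw [if_neg h0, if_neg h0]
  by_cases h1 : i.val + 1 + tailIndex μ ε < d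
  · rw [if_pos h1, if_neg (by omega), if_neg (by omega)]; ring
  rw [if_neg h1]
  by_cases h2 : i.val + 1 + tailIndex μ ε = d
  · rw [if_pos h2, if_pos (by omega), if_neg (by omega)]; ring
  · rw [if_neg h2, if_neg (by omega), if_pos (by omega)]; ring

/-- The gain `ε` sits at the head, hence in every nonempty prefix. Losses start only at the cut
entry, and a prefix that contains this entry carries all the mass. -/
theorem steepened_spec (hμ0 : ∀ i, 0 ≤ μ i) (hμ1 : ∑ i, μ i = 1) (hε : 0 < ε) :
    (∀ i, 0 ≤ steepened μ ε i) ∧ ∑ i, steepened μ ε i = 1 ∧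
    (∑ i, |μ i - steepened μ ε i|) / 2 ≤ ε ∧
    ∀ k : ℕ, 1 ≤ k → ∑ i with (i : Fin d).val < k, steepened μ ε i = 1 ∨
      ∑ i with (i : Fin d).val < k, steepened μ ε i = ∑ i with (i : Fin d).val < k, μ i + ε := by
  have hd : 0 < d := by
    rcases Nat.eq_zero_or_pos d with rfl | h
    · simp at hμ1
    · exact h
  have hQ := tailSum_tailIndex_le (μ := μ) hε.le
  have hQ0 : 0 ≤ tailSum μ (tailIndex μ ε) := Finset.sum_nonneg fun i _ => hμ0 i
  have hle := tailIndex_le (μ := μ) (ε := ε)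
  set z : Fin d := ⟨0, hd⟩ with hz
  by_cases h : tailIndex μ ε + 1 = d
  · have hs := steepened_eq_single h z rfl
    have hsum : ∑ i, steepened μ ε i = 1 := by simp [hs]
    refine ⟨fun i => by rw [hs]; split_ifs <;> norm_num, hsum, ?_, fun k hk => Or.inl ?_⟩
    -- Here the distance is `1 - μ z`, which is the tail sum of length `d - 1`.
    · have h1 := head_add_tailSum (μ := μ) z rfl
      have h2 : tailIndex μ ε = d - 1 := by omega
      rw [h2] at hQ
      have h3 : ∀ i, |μ i - steepened μ ε i| = μ i + if i = z then 1 - 2 * μ z else 0 := by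
        intro i
        rw [hs]
        split_ifs with hi
        · have := le_one_of_sum_eq_one hμ0 hμ1 z
          rw [hi, abs_of_nonpos (by linarith)]; ring
        · simp [abs_of_nonneg (hμ0 i)]
      simp only [h3, Finset.sum_add_distrib, hμ1]
      simp
      linarith
    · rw [prefix_eq_sum, hsum]
      intro i hi
      rw [hs, if_neg]
      rintro rfl
      simp [hz] at hi
      omega
  · have hlt : tailIndex μ ε + 1 < d := by omega
    set k₀ : Fin d := ⟨d - 1 - tailIndex μ ε, by omega⟩ with hk₀
    have hk : k₀.val + 1 + tailIndex μ ε = d := by simp only [hk₀]; omega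
    have hs := steepened_eq_add hlt z k₀ rfl hk
    -- Maximality of the tail index says that the entry at `k₀` is large enough to lose the
    -- remaining `ε - Q`.
    have hQ1 := lt_tailSum_of_tailIndex_lt (μ := μ) (ε := ε) (l := tailIndex μ ε + 1)
      (by omega) (by omega)
    rw [tailSum_succ k₀ hk] at hQ1
    have htail : ∑ i : Fin d, (if d ≤ i.val + tailIndex μ ε then μ i else 0) =
        tailSum μ (tailIndex μ ε) := by rw [tailSum, Finset.sum_filter]
    have hsum : ∑ i, steepened μ ε i = 1 := by
      simp only [hs, Finset.sum_sub_distrib, Finset.sum_add_distrib, htail, hμ1]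
      simp
      ring
    refine ⟨fun i => ?_, hsum, ?_, fun k hk1 => ?_⟩
    · rw [hs]
      by_cases h2 : d ≤ i.val + tailIndex μ ε
      · rw [if_pos h2, if_neg (fun h : i = k₀ => by rw [h] at h2; omega)]
        split_ifs <;> linarith
      · rw [if_neg h2]
        have := hμ0 i
        by_cases h3 : i = k₀
        · rw [if_pos h3, h3]
          split_ifs <;> linarith
        · rw [if_neg h3]
          split_ifs <;> linarith
    · have h3 : ∀ i, |μ i - steepened μ ε i| ≤ (if i = z then ε else 0)
          + (if i = k₀ then ε - tailSum μ (tailIndex μ ε) else 0)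
          + (if d ≤ i.val + tailIndex μ ε then μ i else 0) := by
        intro i
        have := hμ0 i
        have h4 : (0 : ℝ) ≤ if i = z then ε else 0 := by split_ifs <;> linarith
        have h5 : (0 : ℝ) ≤ if i = k₀ then ε - tailSum μ (tailIndex μ ε) else 0 := by
          split_ifs <;> linarith
        have h6 : (0 : ℝ) ≤ if d ≤ i.val + tailIndex μ ε then μ i else 0 := by
          split_ifs <;> linarith
        rw [hs, abs_le]
        constructor <;> linarith
      have h7 := Finset.sum_le_sum fun i (_ : i ∈ Finset.univ) => h3 i
      simp only [Finset.sum_add_distrib, htail] at h7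
      simp only [Finset.sum_ite_eq', Finset.mem_univ, if_true] at h7
      linarith
    · by_cases hkk : k ≤ k₀.val
      · right
        have h8 : ∀ i ∈ Finset.univ.filter (fun i : Fin d => i.val < k),
            steepened μ ε i = μ i + if i = z then ε else 0 := by
          intro i hi
          have hi' : i.val < k := (Finset.mem_filter.1 hi).2
          rw [hs, if_neg (fun h : i = k₀ => by rw [h] at hi'; omega),
            if_neg (by omega : ¬ d ≤ i.val + tailIndex μ ε)]
          ring
        rw [Finset.sum_congr rfl h8, Finset.sum_add_distrib, Finset.sum_ite_eq', if_pos]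
        simp [hz]
        omega
      · left
        rw [prefix_eq_sum, hsum]
        intro i hi
        have h9 : d ≤ i.val + tailIndex μ ε := by omega
        rw [hs, if_pos h9, if_neg (fun h : i = k₀ => by rw [h] at hi; omega),
          if_neg (fun h : i = z => by rw [h] at hi; simp [hz] at hi; omega)]
        ring

end Steepened

/-! ### The entropy-maximizing vector. -/

section Flattened

open Real

variable {d : ℕ} {μ : Fin d → ℝ} {ε : ℝ}

/-- The total mass needed to raise all entries of `μ` to at least `t`. -/
noncomputable def lowExcess (μ : Fin d → ℝ) (t : ℝ) : ℝ := ∑ i, max (t - μ i) 0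

/-- The total mass removed when all entries of `μ` are cut at `t`. -/
noncomputable def highExcess (μ : Fin d → ℝ) (t : ℝ) : ℝ := ∑ i, max (μ i - t) 0

theorem lowExcess_mono : Monotone (lowExcess μ) := fun s t h =>
  Finset.sum_le_sum fun i _ => max_le_max_right 0 (by linarith)

theorem highExcess_anti : Antitone (highExcess μ) := fun s t h =>
  Finset.sum_le_sum fun i _ => max_le_max_right 0 (by linarith)

theorem continuous_lowExcess : Continuous (lowExcess μ) := by
  unfold lowExcess; fun_prop

theorem continuous_highExcess : Continuous (highExcess μ) := by
  unfold highExcess; fun_prop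

/-- Deviations from the mean cancel, so their positive and negative parts have equal mass. Hence `τ`
being out of reach puts a level on each side of `1/d`. -/
theorem lowExcess_highExcess_mean (hd : 0 < d) (hμ1 : ∑ i, μ i = 1) :
    lowExcess μ (1 / d) = (∑ i, |μ i - 1 / d|) / 2 ∧
      highExcess μ (1 / d) = (∑ i, |μ i - 1 / d|) / 2 := by
  have h1 : lowExcess μ (1 / d) + highExcess μ (1 / d) = ∑ i, |μ i - 1 / d| := by
    rw [lowExcess, highExcess, ← Finset.sum_add_distrib]
    refine Finset.sum_congr rfl fun i _ => ?_
    rcases le_total (μ i) (1 / d) with h | h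
    · rw [max_eq_left (by linarith), max_eq_right (by linarith), abs_of_nonpos (by linarith)]
      ring
    · rw [max_eq_right (by linarith), max_eq_left (by linarith), abs_of_nonneg (by linarith)]
      ring
  have h2 : highExcess μ (1 / d) - lowExcess μ (1 / d) = 0 := by
    rw [lowExcess, highExcess, ← Finset.sum_sub_distrib]
    have : ∀ i, max (μ i - 1 / (d : ℝ)) 0 - max (1 / (d : ℝ) - μ i) 0 = μ i - 1 / (d : ℝ) := by
      intro i
      rcases le_total (μ i) (1 / d) with h | h
      · rw [max_eq_left (by linarith : 0 ≤ 1 / (d : ℝ) - μ i), max_eq_right (by linarith)]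
        ring
      · rw [max_eq_right (by linarith : 1 / (d : ℝ) - μ i ≤ 0), max_eq_left (by linarith)]
        ring
    simp only [this, Finset.sum_sub_distrib, hμ1, sum_inv_card hd, sub_self]
  constructor <;> linarith

/-- In a sorted vector the entries below `t` form a final segment, determined by its length. -/
theorem lt_iff_card_add (hμ : Antitone μ) (t : ℝ) (i : Fin d) :
    μ i < t ↔ d ≤ i.val + (Finset.univ.filter fun j => μ j < t).card := by
  constructor
  · intro h
    have := Finset.card_le_card (s := Finset.Ici i) (t := Finset.univ.filter fun j => μ j < t)
      fun j hj => Finset.mem_filter.2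
        ⟨Finset.mem_univ j, (hμ (Finset.mem_Ici.1 hj)).trans_lt h⟩
    rw [Fin.card_Ici] at this
    omega
  · intro h
    by_contra hlt
    have := Finset.card_le_card (t := Finset.Ioi i) (s := Finset.univ.filter fun j => μ j < t)
      fun j hj => Finset.mem_Ioi.2 (by
        by_contra hji
        have h1 := hμ (not_lt.1 hji)
        have h2 := (Finset.mem_filter.1 hj).2
        linarith)
    rw [Fin.card_Ioi] at this
    have := i.isLt
    omega

theorem gt_iff_lt_card (hμ : Antitone μ) (t : ℝ) (i : Fin d) :
    t < μ i ↔ i.val < (Finset.univ.filter fun j => t < μ j).card := by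
  constructor
  · intro h
    have := Finset.card_le_card (s := Finset.Iic i) (t := Finset.univ.filter fun j => t < μ j)
      fun j hj => Finset.mem_filter.2
        ⟨Finset.mem_univ j, h.trans_le (hμ (Finset.mem_Iic.1 hj))⟩
    rw [Fin.card_Iic] at this
    omega
  · intro h
    by_contra hlt
    have := Finset.card_le_card (t := Finset.Iio i) (s := Finset.univ.filter fun j => t < μ j)
      fun j hj => Finset.mem_Iio.2 (by
        by_contra hji
        have h1 := hμ (not_lt.1 hji)
        have h2 := (Finset.mem_filter.1 hj).2
        linarith)
    rw [Fin.card_Iio] at this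
    omega

theorem sum_filter_abs_eq_lowExcess {a : ℝ} {n : ℕ}
    (h : ∀ i : Fin d, if d ≤ i.val + n then μ i ≤ a else a ≤ μ i) :
    ∑ i with d ≤ (i : Fin d).val + n, |a - μ i| = lowExcess μ a := by
  rw [Finset.sum_filter, lowExcess]
  refine Finset.sum_congr rfl fun i _ => ?_
  have := h i
  split_ifs at this ⊢
  · rw [abs_of_nonneg (by linarith), max_eq_left (by linarith)]
  · rw [max_eq_right (by linarith)]

theorem sum_filter_abs_eq_highExcess {c : ℝ} {m : ℕ}
    (h : ∀ i : Fin d, if i.val < m then c ≤ μ i else μ i ≤ c) :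
    ∑ i with (i : Fin d).val < m, |c - μ i| = highExcess μ c := by
  rw [Finset.sum_filter, highExcess]
  refine Finset.sum_congr rfl fun i _ => ?_
  have := h i
  split_ifs at this ⊢
  · rw [abs_of_nonpos (by linarith), max_eq_left (by linarith)]; ring
  · rw [max_eq_right (by linarith)]

/-- The level comes from the intermediate value theorem on `[0, 1/d]`, and `n` counts the entries
strictly below it. Some entry is below as `ε > 0`, and not all are, since the total would then be
less than `1`. -/
theorem exists_isLowLevel (hμ : Antitone μ) (hμ0 : ∀ i, 0 ≤ μ i) (hμ1 : ∑ i, μ i = 1)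
    (hd : 0 < d) (hε : 0 < ε) (hτ : ε < lowExcess μ (1 / d)) : ∃ p, IsLowLevel μ ε p := by
  have hd' : (1 : ℝ) ≤ d := by exact_mod_cast hd
  have hd1 : 1 / (d : ℝ) ≤ 1 := by rw [div_le_one (by linarith)]; exact hd'
  have hF0 : lowExcess μ 0 = 0 := Finset.sum_eq_zero fun i _ => max_eq_right (by linarith [hμ0 i])
  obtain ⟨a, ⟨ha0, ha1⟩, ha⟩ := intermediate_value_Icc (f := lowExcess μ) (a := 0) (b := 1 / (d : ℝ))
    (by positivity) continuous_lowExcess.continuousOn (show ε ∈ Set.Icc _ _ from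
      ⟨by rw [hF0]; exact hε.le, hτ.le⟩)
  have hiff := lt_iff_card_add hμ a
  set n := (Finset.univ.filter fun j => μ j < a).card with hn
  have hn1 : 1 ≤ n := by
    by_contra! h0
    have : lowExcess μ a = 0 := Finset.sum_eq_zero fun i _ => by
      have h1 : ¬ μ i < a := by rw [hiff]; omega
      exact max_eq_right (by linarith)
    linarith
  have hnd : n + 1 ≤ d := by
    by_contra! h0
    have h1 : ∑ i, μ i < ∑ _i : Fin d, 1 / (d : ℝ) :=
      Finset.sum_lt_sum_of_nonempty ⟨⟨0, hd⟩, Finset.mem_univ _⟩ fun i _ =>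
        ((hiff i).2 (by omega)).trans_le ha1
    rw [hμ1, sum_inv_card hd] at h1
    exact lt_irrefl _ h1
  refine ⟨(a, n), ⟨ha0, ha1.trans hd1⟩, hn1, hnd, ?_, fun i hi => (hiff i).2 hi.ge,
    fun i hi => not_lt.1 fun h => ?_⟩
  · rw [← ha]
    refine sum_filter_abs_eq_lowExcess fun i => ?_
    split_ifs with h
    · exact ((hiff i).2 h).le
    · exact not_lt.1 fun h' => h ((hiff i).1 h')
  · have := (hiff i).1 h
    simp only at hi
    omega

theorem exists_isHighLevel (hμ : Antitone μ) (hμ0 : ∀ i, 0 ≤ μ i) (hμ1 : ∑ i, μ i = 1)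
    (hd : 0 < d) (hε : 0 < ε) (hτ : ε < highExcess μ (1 / d)) : ∃ p, IsHighLevel μ ε p := by
  have hd' : (1 : ℝ) ≤ d := by exact_mod_cast hd
  have hd1 : 1 / (d : ℝ) ≤ 1 := by rw [div_le_one (by linarith)]; exact hd'
  have hd0 : 0 ≤ 1 / (d : ℝ) := by positivity
  have hF0 : highExcess μ 1 = 0 := Finset.sum_eq_zero fun i _ =>
    max_eq_right (by linarith [le_one_of_sum_eq_one hμ0 hμ1 i])
  obtain ⟨c, ⟨hc0, hc1⟩, hc⟩ := intermediate_value_Icc' (f := highExcess μ) (a := 1 / (d : ℝ))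
    (b := 1) hd1 continuous_highExcess.continuousOn (show ε ∈ Set.Icc _ _ from
      ⟨by rw [hF0]; exact hε.le, hτ.le⟩)
  have hiff := gt_iff_lt_card hμ c
  set m := (Finset.univ.filter fun j => c < μ j).card with hm
  have hm1 : 1 ≤ m := by
    by_contra! h0
    have : highExcess μ c = 0 := Finset.sum_eq_zero fun i _ => by
      have h1 : ¬ c < μ i := by rw [hiff]; omega
      exact max_eq_right (by linarith)
    linarith
  have hmd : m + 1 ≤ d := by
    by_contra! h0
    have h1 : ∑ _i : Fin d, 1 / (d : ℝ) < ∑ i, μ i :=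
      Finset.sum_lt_sum_of_nonempty ⟨⟨0, hd⟩, Finset.mem_univ _⟩ fun i _ =>
        hc0.trans_lt ((hiff i).2 (by omega))
    rw [hμ1, sum_inv_card hd] at h1
    exact lt_irrefl _ h1
  refine ⟨(c, m), ⟨hd0.trans hc0, hc1⟩, hm1, hmd, ?_, fun i hi => not_lt.1 fun h => ?_,
    fun i hi => (hiff i).2 (by simp only at hi; omega)⟩
  · rw [← hc]
    refine sum_filter_abs_eq_highExcess fun i => ?_
    split_ifs with h
    · exact ((hiff i).2 h).le
    · exact not_lt.1 fun h' => h ((hiff i).1 h')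
  · have := (hiff i).1 h
    simp only at hi
    omega

/-- The chosen pairs enter later only through this truncation formula and the two excess equations.
Existence of the pairs suffices here, not uniqueness. -/
theorem flattened_spec (hμ : Antitone μ) (hμ0 : ∀ i, 0 ≤ μ i) (hμ1 : ∑ i, μ i = 1)
    (hd : 0 < d) (hε : 0 < ε) (hτ : ε < (∑ i, |μ i - 1 / d|) / 2) :
    ∃ a c : ℝ, 0 < a ∧ a < 1 / d ∧ 1 / d < c ∧ c ≤ 1 ∧ lowExcess μ a = ε ∧
      highExcess μ c = ε ∧ ∀ i, flattened μ ε i = max a (min c (μ i)) := by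
  obtain ⟨hlow, hhigh⟩ := lowExcess_highExcess_mean hd hμ1
  obtain ⟨-, hn1, hnd, hsumL, hL1, hL2⟩ : IsLowLevel μ ε (lowLevel μ ε) :=
    Classical.epsilon_spec (exists_isLowLevel hμ hμ0 hμ1 hd hε (by rw [hlow]; exact hτ))
  obtain ⟨⟨-, hc1⟩, hm1, hmd, hsumH, hH1, hH2⟩ : IsHighLevel μ ε (highLevel μ ε) :=
    Classical.epsilon_spec (exists_isHighLevel hμ hμ0 hμ1 hd hε (by rw [hhigh]; exact hτ))
  set a := (lowLevel μ ε).1 with ha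
  set n := (lowLevel μ ε).2 with hn
  set c := (highLevel μ ε).1 with hc
  set m := (highLevel μ ε).2 with hm
  have hlow1 : ∀ i : Fin d, d ≤ i.val + n → μ i < a := fun i hi =>
    (hμ (show (⟨d - n, by omega⟩ : Fin d) ≤ i by
      change d - n ≤ i.val; omega)).trans_lt (hL1 _ (by change d - n + n = d; omega))
  have hlow2 : ∀ i : Fin d, ¬ d ≤ i.val + n → a ≤ μ i := fun i hi =>
    (hL2 ⟨d - n - 1, by omega⟩ (by change d - n - 1 + 1 + n = d; omega)).trans
      (hμ (by change i.val ≤ d - n - 1; omega))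
  have hhigh1 : ∀ i : Fin d, i.val < m → c < μ i := fun i hi =>
    (hH2 ⟨m - 1, by omega⟩ (by change m - 1 + 1 = m; omega)).trans_le
      (hμ (by change i.val ≤ m - 1; omega))
  have hhigh2 : ∀ i : Fin d, ¬ i.val < m → μ i ≤ c := fun i hi =>
    (hμ (show (⟨m, by omega⟩ : Fin d) ≤ i by change m ≤ i.val; omega)).trans (hH1 _ rfl)
  rw [sum_filter_abs_eq_lowExcess fun i => by
    split_ifs with h
    · exact (hlow1 i h).le
    · exact hlow2 i h] at hsumL
  rw [sum_filter_abs_eq_highExcess fun i => by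
    split_ifs with h
    · exact (hhigh1 i h).le
    · exact hhigh2 i h] at hsumH
  have had : a < 1 / d := by
    by_contra! h
    have := lowExcess_mono (μ := μ) h
    linarith
  have hcd : 1 / d < c := by
    by_contra! h
    have := highExcess_anti (μ := μ) h
    linarith
  refine ⟨a, c, ?_, had, hcd, hc1, hsumL, hsumH, fun i => ?_⟩
  · exact (hμ0 _).trans_lt (hlow1 ⟨d - n, by omega⟩ (by change d ≤ d - n + n; omega))
  · rw [flattened]
    split_ifs with h1 h2
    · rw [max_eq_left ((min_le_right _ _).trans (hlow1 i h1).le)]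
    · rw [min_eq_left (hhigh1 i h2).le, max_eq_right (by linarith)]
    · rw [min_eq_right (hhigh2 i h2), max_eq_right (hlow2 i h1)]

theorem max_min_eq {a c x : ℝ} (hac : a ≤ c) :
    max a (min c x) = x + max (a - x) 0 - max (x - c) 0 := by
  rcases le_total x a with h | h
  · rw [min_eq_right (h.trans hac), max_eq_left h, max_eq_left (by linarith),
      max_eq_right (by linarith)]
    ring
  rcases le_total x c with h' | h'
  · rw [min_eq_right h', max_eq_right h, max_eq_right (by linarith), max_eq_right (by linarith)]
    ring
  · rw [min_eq_left h', max_eq_right hac, max_eq_right (by linarith), max_eq_left (by linarith)]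
    ring

theorem flattened_isProbability (hμ : Antitone μ) (hμ0 : ∀ i, 0 ≤ μ i) (hμ1 : ∑ i, μ i = 1)
    (hd : 0 < d) (hε : 0 < ε) (hτ : ε < (∑ i, |μ i - 1 / d|) / 2) :
    (∀ i, 0 ≤ flattened μ ε i) ∧ ∑ i, flattened μ ε i = 1 ∧
      (∑ i, |flattened μ ε i - μ i|) / 2 ≤ ε := by
  obtain ⟨a, c, ha, had, hcd, -, hlow, hhigh, hr⟩ := flattened_spec hμ hμ0 hμ1 hd hε hτ
  have hac : a ≤ c := by linarith
  have hr' : ∀ i, flattened μ ε i = μ i + max (a - μ i) 0 - max (μ i - c) 0 := fun i => by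
    rw [hr, max_min_eq hac]
  refine ⟨fun i => ?_, ?_, ?_⟩
  · rw [hr]; exact ha.le.trans (le_max_left _ _)
  · unfold lowExcess at hlow
    unfold highExcess at hhigh
    simp only [hr', Finset.sum_sub_distrib, Finset.sum_add_distrib, hlow, hhigh, hμ1]
    ring
  · have h : ∑ i, |flattened μ ε i - μ i| ≤ lowExcess μ a + highExcess μ c := by
      rw [lowExcess, highExcess, ← Finset.sum_add_distrib]
      refine Finset.sum_le_sum fun i _ => ?_
      have h1 := le_max_right (a - μ i) 0
      have h2 := le_max_right (μ i - c) 0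
      rw [hr', abs_le]
      constructor <;> linarith
    linarith

/-- Among the probability vectors near `μ`, the flattened one has the largest entropy. -/
theorem sum_negMulLog_le_flattened {w : Fin d → ℝ} (hμ : Antitone μ) (hμ0 : ∀ i, 0 ≤ μ i)
    (hμ1 : ∑ i, μ i = 1) (hd : 0 < d) (hε : 0 < ε) (hτ : ε < (∑ i, |μ i - 1 / d|) / 2)
    (hw0 : ∀ i, 0 ≤ w i) (hw1 : ∑ i, w i = 1) (hw : (∑ i, |w i - μ i|) / 2 ≤ ε) :
    ∑ i, negMulLog (w i) ≤ ∑ i, negMulLog (flattened μ ε i) := by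
  obtain ⟨-, hsum, -⟩ := flattened_isProbability hμ hμ0 hμ1 hd hε hτ
  obtain ⟨a, c, ha, had, hcd, -, hlow, hhigh, hr⟩ := flattened_spec hμ hμ0 hμ1 hd hε hτ
  have hac : a ≤ c := by linarith
  have hpos : ∀ i, 0 < flattened μ ε i := fun i => by
    rw [hr]; exact ha.trans_le (le_max_left _ _)
  set g : Fin d → ℝ := fun i => -log (flattened μ ε i) with hg
  have hg1 : ∀ i, g i ≤ -log a := fun i => by
    simp only [hg, neg_le_neg_iff]
    exact log_le_log ha (by rw [hr]; exact le_max_left _ _)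
  have hg2 : ∀ i, -log c ≤ g i := fun i => by
    simp only [hg, neg_le_neg_iff]
    exact log_le_log (hpos i) (by rw [hr]; exact max_le hac (min_le_left _ _))
  -- `g` ranges over `[-log c, -log a]`. Subtracting its midpoint is free because `w - μ` sums to
  -- zero, and leaves half the length of the interval as the price of each unit of `|w i - μ i|`.
  have hterm : ∀ i, w i * g i ≤ flattened μ ε i * g i + |w i - μ i| * ((log c - log a) / 2)
      - (max (a - μ i) 0 * -log a - max (μ i - c) 0 * -log c)
      + (w i - μ i) * (-(log a + log c) / 2) := by
    intro i
    have e1 : max (a - μ i) 0 * g i = max (a - μ i) 0 * -log a := by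
      rcases le_total (μ i) a with h | h
      · have : flattened μ ε i = a := by rw [hr, min_eq_right (h.trans hac), max_eq_left h]
        simp only [hg, this]
      · rw [max_eq_right (by linarith)]; ring
    have e2 : max (μ i - c) 0 * g i = max (μ i - c) 0 * -log c := by
      rcases le_total c (μ i) with h | h
      · have : flattened μ ε i = c := by rw [hr, min_eq_left h, max_eq_right hac]
        simp only [hg, this]
      · rw [max_eq_right (by linarith)]; ring
    have e3 : flattened μ ε i * g i = μ i * g i + max (a - μ i) 0 * -log a
        - max (μ i - c) 0 * -log c := by
      rw [← e1, ← e2, hr i, max_min_eq hac]; ring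
    have e4 : (w i - μ i) * (g i - -(log a + log c) / 2) ≤
        |w i - μ i| * ((log c - log a) / 2) := by
      refine (le_abs_self _).trans ?_
      rw [abs_mul]
      refine mul_le_mul_of_nonneg_left ?_ (abs_nonneg _)
      have := hg1 i
      have := hg2 i
      rw [abs_le]
      constructor <;> linarith
    rw [e3]
    linarith
  have hS := Finset.sum_le_sum fun i (_ : i ∈ Finset.univ) => hterm i
  simp only [Finset.sum_add_distrib, Finset.sum_sub_distrib, ← Finset.sum_mul, hw1, hμ1] at hS
  unfold lowExcess at hlow
  unfold highExcess at hhigh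
  rw [hlow, hhigh] at hS
  have hlog := log_le_log ha hac
  have hmul := mul_le_mul_of_nonneg_right hw (by linarith : 0 ≤ log c - log a)
  have hG := sum_negMulLog_le hw0 hpos (hw1.trans hsum.symm)
  have h1 : ∑ i, -(w i * log (flattened μ ε i)) = ∑ i, w i * g i := by simp [hg]
  have h2 : ∑ i, negMulLog (flattened μ ε i) = ∑ i, flattened μ ε i * g i := by
    simp [hg, negMulLog]
  rw [h1] at hG
  rw [h2]
  linarith

theorem sum_abs_single_sub_mean (hd : 0 < d) (z : Fin d)
    (hz : ∀ i, μ i = if i = z then 1 else 0) :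
    (∑ i, |μ i - 1 / d|) / 2 = 1 - 1 / d := by
  have hd' : (1 : ℝ) ≤ d := by exact_mod_cast hd
  have hd1 : 1 / (d : ℝ) ≤ 1 := by rw [div_le_one (by linarith)]; exact hd'
  have hd0 : 0 ≤ 1 / (d : ℝ) := by positivity
  have : ∀ i, |μ i - 1 / (d : ℝ)| = if i = z then 1 - 1 / (d : ℝ) else 1 / (d : ℝ) := by
    intro i
    rw [hz]
    split_ifs
    · rw [abs_of_nonneg (by linarith)]
    · rw [abs_of_nonpos (by linarith)]; ring
  simp only [this, sum_ite_eq_card]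
  field_simp
  ring

/-- The flattening of a point mass is a spike vector. -/
theorem flattened_single (hμ : Antitone μ) (hd : 1 < d) (hε : 0 < ε)
    (hεd : ε < 1 - 1 / (d : ℝ)) (z : Fin d) (hz : ∀ i, μ i = if i = z then 1 else 0) (i : Fin d) :
    flattened μ ε i = spikeKernel d ε i z := by
  have hd' : (1 : ℝ) < d := by exact_mod_cast hd
  have hd1 : 1 / (d : ℝ) ≤ 1 := by rw [div_le_one (by linarith)]; exact hd'.le
  have hd0 : 0 ≤ 1 / (d : ℝ) := by positivity
  obtain ⟨a, c, ha, had, hcd, hc1, hlow, hhigh, hr⟩ := flattened_spec hμ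
    (fun i => by rw [hz]; split_ifs <;> norm_num) (by simp [hz]) (by omega) hε
    (by rw [sum_abs_single_sub_mean (by omega) z hz]; exact hεd)
  have h1 : ∀ i, max (a - μ i) 0 = if i = z then 0 else a := by
    intro i
    rw [hz]
    split_ifs
    · exact max_eq_right (by linarith)
    · rw [sub_zero, max_eq_left ha.le]
  have h2 : ∀ i, max (μ i - c) 0 = if i = z then 1 - c else 0 := by
    intro i
    rw [hz]
    split_ifs
    · exact max_eq_left (by linarith)
    · exact max_eq_right (by linarith)
  -- The two level equations become `(d - 1) * a = ε` and `1 - c = ε`.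
  simp only [lowExcess, h1, sum_ite_eq_card] at hlow
  simp only [highExcess, h2, sum_ite_eq_card] at hhigh
  rw [hr, spikeKernel, hz]
  split_ifs
  · rw [min_eq_left hc1, max_eq_right (by linarith)]; linarith
  · rw [min_eq_right (by linarith), max_eq_left ha.le, eq_div_iff (by linarith)]; linarith

end Flattened

/-! ### From vectors back to states, and the equality cases. -/

section Bounds

open Real

variable {H : Type*} [NormedAddCommGroup H] [InnerProductSpace ℂ H] {d : ℕ} {ε : ℝ}
  {b : OrthonormalBasis (Fin d) ℂ H} {μ : Fin d → ℝ}

theorem IsState.dim_pos (hσ : IsState (diagOp b μ)) : 0 < d := by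
  rcases Nat.eq_zero_or_pos d with rfl | h
  · simpa using hσ.sum_eigenvalue
  · exact h

theorem traceNorm_sub_mixedState [CompleteSpace H] (hd : Module.finrank ℂ H = d) :
    traceNorm (diagOp b μ - mixedState H) = ∑ i, |μ i - 1 / d| := by
  rw [mixedState_eq_diagOp hd b, diagOp_sub, traceNorm_diagOp]

theorem rhoUpper_spec [CompleteSpace H] (hd : Module.finrank ℂ H = d) (hμ : Antitone μ)
    (hσ : IsState (diagOp b μ)) (hε : 0 < ε) :
    ∃ u : Fin d → ℝ, rhoUpper ε (diagOp b μ) b μ = diagOp b u ∧ (∀ i, 0 ≤ u i) ∧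
      ∑ i, u i = 1 ∧ (∑ i, |u i - μ i|) / 2 ≤ ε ∧
      ∀ w : Fin d → ℝ, (∀ i, 0 ≤ w i) → ∑ i, w i = 1 → (∑ i, |w i - μ i|) / 2 ≤ ε →
        ∑ i, negMulLog (w i) ≤ ∑ i, negMulLog (u i) := by
  have hd0 := hσ.dim_pos
  have hμ0 := hσ.eigenvalue_nonneg
  have hμ1 := hσ.sum_eigenvalue
  by_cases h : traceNorm (diagOp b μ - mixedState H) / 2 ≤ ε
  · refine ⟨fun _ => 1 / d, by rw [rhoUpper, if_pos h, mixedState_eq_diagOp hd b],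
      fun i => by positivity, sum_inv_card hd0, ?_, fun w hw0 hw1 _ => ?_⟩
    · rw [traceNorm_sub_mixedState hd] at h
      simpa only [abs_sub_comm] using h
    · rw [sum_negMulLog_const hd0]
      exact sum_negMulLog_le_log hd0 hw0 hw1
  · have hτ : ε < (∑ i, |μ i - 1 / d|) / 2 := by
      rw [← traceNorm_sub_mixedState hd (b := b)]; exact not_le.1 h
    obtain ⟨h0, h1, h2⟩ := flattened_isProbability hμ hμ0 hμ1 hd0 hε hτ
    exact ⟨flattened μ ε, by rw [rhoUpper, if_neg h], h0, h1, h2,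
      fun w hw0 hw1 hw => sum_negMulLog_le_flattened hμ hμ0 hμ1 hd0 hε hτ hw0 hw1 hw⟩

/-- By Ky Fan the prefix sums of `w` are at most those of the steepened vector, so Schur concavity
applies. -/
theorem steepened_le_entropy [CompleteSpace H] [FiniteDimensional ℂ H] (hμ : Antitone μ)
    (hσ : IsState (diagOp b μ)) (hε : 0 < ε) {e : OrthonormalBasis (Fin d) ℂ H} {w : Fin d → ℝ}
    (hw : Antitone w) (hω : diagOp e w ∈ ball ε (diagOp b μ)) :
    ∑ i, negMulLog (steepened μ ε i) ≤ ∑ i, negMulLog (w i) := by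
  obtain ⟨h0, h1, -, hpre⟩ := steepened_spec hσ.eigenvalue_nonneg hσ.sum_eigenvalue hε
  refine sum_negMulLog_le_of_prefix_le hω.1.eigenvalue_nonneg h0 hω.1.sum_eigenvalue h1 hw
    fun k => ?_
  rcases Nat.eq_zero_or_pos k with rfl | hk
  · simp
  rcases hpre k hk with h | h
  · rw [h, ← hω.1.sum_eigenvalue]
    exact Finset.sum_le_sum_of_subset_of_nonneg (Finset.filter_subset _ _)
      fun i _ _ => hω.1.eigenvalue_nonneg i
  · rw [h]
    have := prefix_eigenvalue_le hμ hσ hω.1 k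
    have := hω.2
    linarith

/-- Pinching in the eigenbasis of `σ` fixes `σ`, so the pinched `ω` remains in the ball while its
entropy can only grow. -/
theorem entropy_le_of_mem_ball [CompleteSpace H] [FiniteDimensional ℂ H]
    {u : Fin d → ℝ}
    (hu : ∀ w : Fin d → ℝ, (∀ i, 0 ≤ w i) → ∑ i, w i = 1 → (∑ i, |w i - μ i|) / 2 ≤ ε →
      ∑ i, negMulLog (w i) ≤ ∑ i, negMulLog (u i))
    {e : OrthonormalBasis (Fin d) ℂ H} {w : Fin d → ℝ} (hω : diagOp e w ∈ ball ε (diagOp b μ)) :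
    ∑ i, negMulLog (w i) ≤ ∑ i, negMulLog (u i) := by
  refine (sum_negMulLog_le_diagEntry b e hω.1.eigenvalue_nonneg).trans
    (hu _ (diagEntry_nonneg b hω.1.1) (hω.1.sum_diagEntry b) ?_)
  have h := sum_abs_diagEntry_le_traceNorm b
    ((diagOp_isSelfAdjoint e w).sub (diagOp_isSelfAdjoint b μ))
  simp only [diagEntry_sub, diagEntry_diagOp_self] at h
  have := hω.2
  linarith

theorem IsPure.eigenvalue_eq (hμ : Antitone μ) (hσ : IsState (diagOp b μ))
    (h : IsPure (diagOp b μ)) (z : Fin d) (hz : z.val = 0) (i : Fin d) :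
    μ i = if i = z then 1 else 0 := by
  have h01 : ∀ i, μ i = 0 ∨ μ i = 1 := by
    intro i
    have h1 : μ i * ∑ j, μ j = μ i * μ i := by
      rw [Finset.mul_sum]
      exact Finset.sum_eq_single i (fun j _ hj => h.eigenvalue_mul_eigenvalue hj.symm) (by simp)
    rw [hσ.sum_eigenvalue, mul_one] at h1
    rcases eq_or_ne (μ i) 0 with h0 | h0
    · exact Or.inl h0
    · exact Or.inr (mul_left_cancel₀ h0 (by rw [mul_one]; exact h1.symm))
  obtain ⟨j, hj⟩ := exists_eq_single_of_zero_or_one hσ.sum_eigenvalue h01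
  have hzj : z = j := by
    by_contra hne
    have h1 : μ j ≤ μ z := hμ (by rw [Fin.le_def]; omega)
    rw [hj, hj, if_pos rfl, if_neg hne] at h1
    linarith
  rw [hzj]; exact hj i

theorem spikeVector_eq_spikeKernel (z : Fin d) (hz : z.val = 0) (i : Fin d) :
    spikeVector d ε i = spikeKernel d ε i z := by
  simp [spikeVector, spikeKernel, Fin.ext_iff, hz]

/-- Each of the two numbers is the top eigenvalue of the same operator, and it is also a diagonal
entry in the other eigenbasis, hence an average of eigenvalues there. -/
theorem eigenvalue_head_of_eq_spike (hμ : Antitone μ) (hd : 1 < d) (hεd : ε < 1 - 1 / (d : ℝ))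
    {c : OrthonormalBasis (Fin d) ℂ H} (h : diagOp b μ = diagOp c (spikeVector d ε)) (z : Fin d)
    (hz : z.val = 0) : μ z = 1 - ε := by
  have hlt := lt_sub_div_card hd hεd
  apply le_antisymm
  · calc μ z = ∑ j, overlap b c z j * spikeVector d ε j := by
          rw [← diagEntry_diagOp, ← h, diagEntry_diagOp_self]
      _ ≤ ∑ j, overlap b c z j * (1 - ε) := by
          refine Finset.sum_le_sum fun j _ =>
            mul_le_mul_of_nonneg_left ?_ (overlap_nonneg b c z j)
          unfold spikeVector
          split_ifs <;> linarith
      _ = 1 - ε := by rw [← Finset.sum_mul, sum_overlap_right, one_mul]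
  · calc 1 - ε = ∑ j, overlap c b z j * μ j := by
          rw [← diagEntry_diagOp, h, diagEntry_diagOp_self, spikeVector, if_pos hz]
      _ ≤ ∑ j, overlap c b z j * μ z :=
          Finset.sum_le_sum fun j _ => mul_le_mul_of_nonneg_left
            (hμ (by rw [Fin.le_def]; omega)) (overlap_nonneg c b z j)
      _ = μ z := by rw [← Finset.sum_mul, sum_overlap_right, one_mul]

/-- The tail after the head weighs `1 - μ z ≤ ε`, so all of it is erased. -/
theorem steepened_eq_single_of_head (hd : 0 < d) (hμ1 : ∑ i, μ i = 1) (z : Fin d)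
    (hz : z.val = 0) (h : 1 - ε ≤ μ z) (i : Fin d) :
    steepened μ ε i = if i = z then 1 else 0 := by
  refine steepened_eq_single ?_ z hz i
  have h1 := head_add_tailSum (μ := μ) z hz
  have h2 := tailIndex_le (μ := μ) (ε := ε)
  by_contra hne
  have := lt_tailSum_of_tailIndex_lt (μ := μ) (ε := ε) (l := d - 1) (by omega) le_rfl
  linarith

theorem sum_negMulLog_single {p : Fin d → ℝ} (z : Fin d) (hp : ∀ i, p i = if i = z then 1 else 0) :
    ∑ i, negMulLog (p i) = 0 :=
  Finset.sum_eq_zero fun i _ => by rw [hp]; split_ifs <;> simp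

theorem audenaertFannes_of_lt (hd : 1 < d) (hε : 0 < ε) (hεd : ε < 1 - 1 / (d : ℝ)) :
    audenaertFannes d ε = fannesNat d ε / log 2 := by
  have hd' : (1 : ℝ) < d := by exact_mod_cast hd
  rw [audenaertFannes, if_pos hεd, binaryEntropy, fannesNat, log_div hε.ne' (by linarith)]
  simp only [logb]
  ring

theorem audenaertFannes_of_le (hεd : 1 - 1 / (d : ℝ) ≤ ε) :
    audenaertFannes d ε = log d / log 2 := by
  rw [audenaertFannes, if_neg (not_lt.2 hεd), logb]

/-- The equality case yields a spike at an unknown place `j`; swapping basis vectors moves it to the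
front. -/
theorem exists_basis_eq_spike (z j : Fin d) (hz : z.val = 0)
    (h : ∀ i, μ i = spikeKernel d ε i j) :
    ∃ c : OrthonormalBasis (Fin d) ℂ H, diagOp b μ = diagOp c (spikeVector d ε) := by
  refine ⟨b.reindex (Equiv.swap j z), ?_⟩
  rw [diagOp_reindex]
  congr 1
  funext i
  rw [h, spikeVector_eq_spikeKernel z hz]
  simp only [spikeKernel, Equiv.swap_apply_eq_iff,
    Equiv.swap_apply_right]

theorem rhoUpper_of_isPure_of_lt [CompleteSpace H] (hd : Module.finrank ℂ H = d)
    (hμ : Antitone μ) (hσ : IsState (diagOp b μ)) (hε : 0 < ε) (hεd : ε < 1 - 1 / (d : ℝ))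
    (h : IsPure (diagOp b μ)) :
    rhoUpper ε (diagOp b μ) b μ = diagOp b (spikeVector d ε) := by
  have hd0 := hσ.dim_pos
  have hμz := h.eigenvalue_eq hμ hσ ⟨0, hd0⟩ rfl
  rw [rhoUpper, if_neg]
  · congr 1
    funext i
    rw [flattened_single hμ (one_lt_of_lt_one_sub hd0 hε hεd) hε hεd _ hμz,
      spikeVector_eq_spikeKernel ⟨0, hd0⟩ rfl]
  · rw [traceNorm_sub_mixedState hd, sum_abs_single_sub_mean hd0 _ hμz]
    exact not_le.2 hεd

theorem rhoUpper_of_isPure_of_le [CompleteSpace H] (hd : Module.finrank ℂ H = d)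
    (hμ : Antitone μ) (hσ : IsState (diagOp b μ)) (hεd : 1 - 1 / (d : ℝ) ≤ ε)
    (h : IsPure (diagOp b μ)) : rhoUpper ε (diagOp b μ) b μ = mixedState H := by
  have hd0 := hσ.dim_pos
  rw [rhoUpper, if_pos]
  rw [traceNorm_sub_mixedState hd,
    sum_abs_single_sub_mean hd0 _ (h.eigenvalue_eq hμ hσ ⟨0, hd0⟩ rfl)]
  exact hεd

theorem steepened_of_spike (hμ : Antitone μ) (hσ : IsState (diagOp b μ)) (hε : 0 < ε)
    (hεd : ε < 1 - 1 / (d : ℝ))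
    (h : ∃ c : OrthonormalBasis (Fin d) ℂ H, diagOp b μ = diagOp c (spikeVector d ε)) :
    ∃ z, ∀ i, steepened μ ε i = if i = z then 1 else 0 := by
  obtain ⟨c, hc⟩ := h
  have hd0 := hσ.dim_pos
  exact ⟨⟨0, hd0⟩, steepened_eq_single_of_head hd0 hσ.sum_eigenvalue _ rfl
    (eigenvalue_head_of_eq_spike hμ (one_lt_of_lt_one_sub hd0 hε hεd) hεd hc _ rfl).ge⟩

theorem eigenvalue_of_eq_mixedState (hd : Module.finrank ℂ H = d)
    (h : diagOp b μ = mixedState H) (i : Fin d) : μ i = 1 / d := by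
  rw [mixedState_eq_diagOp hd b] at h
  rw [← diagEntry_diagOp_self b μ, h, diagEntry_diagOp_self]

theorem steepened_of_mixedState (hd : Module.finrank ℂ H = d) (hσ : IsState (diagOp b μ))
    (hεd : 1 - 1 / (d : ℝ) ≤ ε) (h : diagOp b μ = mixedState H) :
    ∃ z, ∀ i, steepened μ ε i = if i = z then 1 else 0 := by
  have hd0 := hσ.dim_pos
  refine ⟨⟨0, hd0⟩, steepened_eq_single_of_head hd0 hσ.sum_eigenvalue _ rfl ?_⟩
  rw [eigenvalue_of_eq_mixedState hd h]
  linarith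

theorem max_sub_div {x y t L : ℝ} (hL : 0 < L) :
    max (x / L - t / L) (t / L - y / L) = max (x - t) (t - y) / L := by
  rw [← sub_div, ← sub_div, max_div_div_right hL.le]

theorem max_entropy_change_le [CompleteSpace H] (hd : Module.finrank ℂ H = d) (hμ : Antitone μ)
    (hσ : IsState (diagOp b μ)) (hε : 0 < ε) :
    max (vonNeumannEntropy (rhoUpper ε (diagOp b μ) b μ) - vonNeumannEntropy (diagOp b μ))
        (vonNeumannEntropy (diagOp b μ) - vonNeumannEntropy (rhoLower ε b μ)) ≤
      audenaertFannes d ε ∧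
    (max (vonNeumannEntropy (rhoUpper ε (diagOp b μ) b μ) - vonNeumannEntropy (diagOp b μ))
        (vonNeumannEntropy (diagOp b μ) - vonNeumannEntropy (rhoLower ε b μ)) =
      audenaertFannes d ε ↔
      IsPure (diagOp b μ) ∨
      (ε < 1 - 1 / (d : ℝ) ∧
        ∃ c : OrthonormalBasis (Fin d) ℂ H, diagOp b μ = diagOp c (spikeVector d ε)) ∨
      (1 - 1 / (d : ℝ) ≤ ε ∧ diagOp b μ = mixedState H)) := by
  have hd0 := hσ.dim_pos
  have hμ0 := hσ.eigenvalue_nonneg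
  have hμ1 := hσ.sum_eigenvalue
  have hL : 0 < log 2 := log_pos one_lt_two
  obtain ⟨u, hu, hu0, hu1, huμ, -⟩ := rhoUpper_spec hd hμ hσ hε
  obtain ⟨hs0, hs1, hsμ, -⟩ := steepened_spec hμ0 hμ1 hε
  have hEu : vonNeumannEntropy (rhoUpper ε (diagOp b μ) b μ) =
      (∑ i, negMulLog (u i)) / log 2 := by rw [hu, vonNeumannEntropy_diagOp]
  have hE0 : IsPure (diagOp b μ) → ∑ i, negMulLog (μ i) = 0 := fun h =>
    sum_negMulLog_single _ (h.eigenvalue_eq hμ hσ ⟨0, hd0⟩ rfl)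
  rcases lt_or_ge ε (1 - 1 / (d : ℝ)) with hεd | hεd
  · have hd1 := one_lt_of_lt_one_sub hd0 hε hεd
    have hspike : ∑ i, negMulLog (spikeVector d ε i) = fannesNat d ε := by
      simp only [spikeVector_eq_spikeKernel ⟨0, hd0⟩ rfl, sum_negMulLog_spikeKernel hd1]
    obtain ⟨hA, hA'⟩ := audenaertFannes_classical hd1 hε hεd hu0 hμ0 hu1 hμ1 huμ
    obtain ⟨hB, hB'⟩ := audenaertFannes_classical hd1 hε hεd hμ0 hs0 hμ1 hs1 hsμ
    -- The vector `u` is not identified with the spike; it is enough that both represent the same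
    -- state and so have equal entropy.
    have hAp : IsPure (diagOp b μ) →
        ∑ i, negMulLog (u i) - ∑ i, negMulLog (μ i) = fannesNat d ε := by
      intro h
      have h1 := hEu
      rw [rhoUpper_of_isPure_of_lt hd hμ hσ hε hεd h, vonNeumannEntropy_diagOp, hspike,
        div_left_inj' hL.ne'] at h1
      rw [hE0 h, ← h1, sub_zero]
    have hBs : (∃ c : OrthonormalBasis (Fin d) ℂ H, diagOp b μ = diagOp c (spikeVector d ε)) →
        ∑ i, negMulLog (μ i) - ∑ i, negMulLog (steepened μ ε i) = fannesNat d ε := by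
      intro h
      obtain ⟨z, hz⟩ := steepened_of_spike hμ hσ hε hεd h
      obtain ⟨c, hc⟩ := h
      have h1 := congrArg vonNeumannEntropy hc
      rw [vonNeumannEntropy_diagOp, vonNeumannEntropy_diagOp, hspike, div_left_inj' hL.ne'] at h1
      rw [sum_negMulLog_single z hz, h1, sub_zero]
    rw [audenaertFannes_of_lt hd1 hε hεd, hEu, rhoLower, vonNeumannEntropy_diagOp,
      vonNeumannEntropy_diagOp, max_sub_div hL, div_left_inj' hL.ne']
    refine ⟨div_le_div_of_nonneg_right (max_le hA hB) hL.le, fun h => ?_, ?_⟩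
    · rcases max_choice (∑ i, negMulLog (u i) - ∑ i, negMulLog (μ i))
        (∑ i, negMulLog (μ i) - ∑ i, negMulLog (steepened μ ε i)) with h1 | h1 <;> rw [h1] at h
      · obtain ⟨j, hj, -⟩ := hA' h
        exact Or.inl (isPure_diagOp_single b j hj)
      · obtain ⟨j, -, hj⟩ := hB' h
        exact Or.inr (Or.inl ⟨hεd, exists_basis_eq_spike ⟨0, hd0⟩ j rfl hj⟩)
    · rintro (h | ⟨-, h⟩ | ⟨h, -⟩)
      · exact le_antisymm (max_le hA hB) ((hAp h).ge.trans (le_max_left _ _))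
      · exact le_antisymm (max_le hA hB) ((hBs h).ge.trans (le_max_right _ _))
      · exact absurd hεd (not_lt.2 h)
  -- A difference of two numbers in `[0, log d]` equals `log d` only at the extremes: entropy `0`
  -- makes `σ` pure, entropy `log d` makes it `τ`.
  · have hμn := sum_negMulLog_nonneg hμ0 hμ1
    have hsn := sum_negMulLog_nonneg hs0 hs1
    have hul := sum_negMulLog_le_log hd0 hu0 hu1
    have hμl := sum_negMulLog_le_log hd0 hμ0 hμ1
    have hle : max (∑ i, negMulLog (u i) - ∑ i, negMulLog (μ i))
        (∑ i, negMulLog (μ i) - ∑ i, negMulLog (steepened μ ε i)) ≤ log d :=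
      max_le (by linarith) (by linarith)
    rw [audenaertFannes_of_le hεd]
    have hAp : IsPure (diagOp b μ) →
        ∑ i, negMulLog (u i) - ∑ i, negMulLog (μ i) = log d := by
      intro h
      have h1 := hEu
      rw [rhoUpper_of_isPure_of_le hd hμ hσ hεd h, mixedState_eq_diagOp hd b,
        vonNeumannEntropy_diagOp, sum_negMulLog_const hd0, div_left_inj' hL.ne'] at h1
      rw [hE0 h, ← h1, sub_zero]
    have hBm : diagOp b μ = mixedState H →
        ∑ i, negMulLog (μ i) - ∑ i, negMulLog (steepened μ ε i) = log d := by
      intro h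
      obtain ⟨z, hz⟩ := steepened_of_mixedState hd hσ hεd h
      simp only [sum_negMulLog_single z hz, eigenvalue_of_eq_mixedState hd h,
        sum_negMulLog_const hd0, sub_zero]
    rw [hEu, rhoLower, vonNeumannEntropy_diagOp, vonNeumannEntropy_diagOp, max_sub_div hL,
      div_left_inj' hL.ne']
    refine ⟨div_le_div_of_nonneg_right hle hL.le, fun h => ?_, ?_⟩
    · rcases max_choice (∑ i, negMulLog (u i) - ∑ i, negMulLog (μ i))
        (∑ i, negMulLog (μ i) - ∑ i, negMulLog (steepened μ ε i)) with h1 | h1 <;> rw [h1] at h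
      · obtain ⟨j, hj⟩ := exists_eq_single_of_sum_negMulLog_eq_zero hμ0 hμ1 (by linarith)
        exact Or.inl (isPure_diagOp_single b j hj)
      · refine Or.inr (Or.inr ⟨hεd, ?_⟩)
        rw [mixedState_eq_diagOp hd b]
        congr 1
        funext i
        exact eq_of_sum_negMulLog_eq_log hd0 hμ0 hμ1 (by linarith) i
    · rintro (h | ⟨h, -⟩ | ⟨-, h⟩)
      · exact le_antisymm hle ((hAp h).ge.trans (le_max_left _ _))
      · exact absurd h (not_lt.2 hεd)
      · exact le_antisymm hle ((hBm h).ge.trans (le_max_right _ _))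

theorem abs_entropy_sub_le [CompleteSpace H] [FiniteDimensional ℂ H]
    (hd : Module.finrank ℂ H = d) (hμ : Antitone μ) (hσ : IsState (diagOp b μ)) (hε : 0 < ε)
    {ω : H →L[ℂ] H} (hω : ω ∈ ball ε (diagOp b μ)) :
    |vonNeumannEntropy ω - vonNeumannEntropy (diagOp b μ)| ≤
      max (vonNeumannEntropy (rhoUpper ε (diagOp b μ) b μ) - vonNeumannEntropy (diagOp b μ))
        (vonNeumannEntropy (diagOp b μ) - vonNeumannEntropy (rhoLower ε b μ)) := by
  have hL : 0 < log 2 := log_pos one_lt_two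
  obtain ⟨e, w, hw, rfl⟩ := exists_isSortedEigenDecomposition hd ω hω.1
  obtain ⟨u, hu, -, -, -, hmax⟩ := rhoUpper_spec hd hμ hσ hε
  have h1 := div_le_div_of_nonneg_right (entropy_le_of_mem_ball hmax hω) hL.le
  have h2 := div_le_div_of_nonneg_right (steepened_le_entropy hμ hσ hε hw hω) hL.le
  rw [hu, rhoLower]
  simp only [vonNeumannEntropy_diagOp]
  rw [abs_le']
  exact ⟨le_max_of_le_left (by linarith), le_max_of_le_right (by linarith)⟩

end Bounds

end LocalEntropyBound

theorem proposition3p3 {H : Type*} [NormedAddCommGroup H] [InnerProductSpace ℂ H]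
    [CompleteSpace H] [FiniteDimensional ℂ H] {d : ℕ} (hd : Module.finrank ℂ H = d)
    (σ : H →L[ℂ] H) (hσ : LocalEntropyBound.IsState σ)
    (ε : ℝ) (hε₀ : 0 < ε) (hε₁ : ε ≤ 1)
    (b : OrthonormalBasis (Fin d) ℂ H) (μ : Fin d → ℝ)
    (hbμ : LocalEntropyBound.IsSortedEigenDecomposition σ b μ) :
    open LocalEntropyBound in
    (∀ ω ∈ ball ε σ,
      |vonNeumannEntropy ω - vonNeumannEntropy σ| ≤
        max (vonNeumannEntropy (rhoUpper ε σ b μ) - vonNeumannEntropy σ)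
          (vonNeumannEntropy σ - vonNeumannEntropy (rhoLower ε b μ))) ∧
    max (vonNeumannEntropy (rhoUpper ε σ b μ) - vonNeumannEntropy σ)
        (vonNeumannEntropy σ - vonNeumannEntropy (rhoLower ε b μ)) ≤ audenaertFannes d ε ∧
    (max (vonNeumannEntropy (rhoUpper ε σ b μ) - vonNeumannEntropy σ)
        (vonNeumannEntropy σ - vonNeumannEntropy (rhoLower ε b μ)) = audenaertFannes d ε ↔
      IsPure σ ∨
      (ε < 1 - 1 / (d : ℝ) ∧
        ∃ c : OrthonormalBasis (Fin d) ℂ H, σ = diagOp c (spikeVector d ε)) ∨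
      (1 - 1 / (d : ℝ) ≤ ε ∧ σ = mixedState H)) ∧
    (IsPure σ →
      (ε < 1 - 1 / (d : ℝ) → rhoUpper ε σ b μ = diagOp b (spikeVector d ε)) ∧
      (1 - 1 / (d : ℝ) ≤ ε → rhoUpper ε σ b μ = mixedState H)) ∧
    (ε < 1 - 1 / (d : ℝ) →
      (∃ c : OrthonormalBasis (Fin d) ℂ H, σ = diagOp c (spikeVector d ε)) →
      IsPure (rhoLower ε b μ)) ∧
    (1 - 1 / (d : ℝ) ≤ ε → σ = mixedState H → IsPure (rhoLower ε b μ)) := by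
  obtain ⟨hμ, rfl⟩ := hbμ
  obtain ⟨hle, hiff⟩ := LocalEntropyBound.max_entropy_change_le hd hμ hσ hε₀
  refine ⟨fun ω hω => LocalEntropyBound.abs_entropy_sub_le hd hμ hσ hε₀ hω, hle, hiff,
    fun h => ⟨fun hεd => LocalEntropyBound.rhoUpper_of_isPure_of_lt hd hμ hσ hε₀ hεd h,
      fun hεd => LocalEntropyBound.rhoUpper_of_isPure_of_le hd hμ hσ hεd h⟩,
    fun hεd h => ?_, fun hεd h => ?_⟩
  · obtain ⟨z, hz⟩ := LocalEntropyBound.steepened_of_spike hμ hσ hε₀ hεd h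
    exact LocalEntropyBound.isPure_diagOp_single b z hz
  · obtain ⟨z, hz⟩ := LocalEntropyBound.steepened_of_mixedState hd hσ hεd h
    exact LocalEntropyBound.isPure_diagOp_single b z hz
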